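/- Let $\mathcal H=\ell^2(\mathbf Z;\mathbf C^2)$, and for $\psi=(\psi^{(0)},\psi^{(1)})\in\mathcal H$ let $(S\psi)(x)=\big(\psi^{(0)}(x+1),\psi^{(1)}(x-1)\big)$. Let $p\in(0,1]$, $q\in[0,1]$ with $p^2+q^2=1$, let $\alpha,\beta,\gamma,\beta',\gamma'\in[0,2\pi)$, and put $$C_0=e^{i\gamma/2}\begin{pmatrix}pe^{i(\alpha-\gamma/2)}&qe^{i(\beta-\gamma/2)}\\-qe^{-i(\beta-\gamma/2)}&pe^{-i(\alpha-\gamma/2)}\end{pmatrix},\qquad C_1=e^{i\gamma'/2}\begin{pmatrix}0&e^{i(\beta'-\gamma'/2)}\\-e^{-i(\beta'-\gamma'/2)}&0\end{pmatrix}.$$ Let $C_2(x)\in U(2)$ ($x\in\mathbf Z$) be such that, for some $\rho,M>0$, every entry of $C_2(x)-C_0$ has modulus at most $Me^{-\rho\sqrt{1+x^2}}$ for all $x\in\mathbf Z$, and such that, for some $\delta>0$, the upper left entry $a_2(x)$ of $C_2(x)$ satisfies $|a_2(x)|\ge\delta$ for all $x\in\mathbf Z$. Let $N\ge1$, $y_1,\dots,y_N\in\mathbf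 Z$, and $\mathbf e=\bigcup_{j=1}^N\{y_j-1,y_j\}$. Put $C(x)=C_1$ for $x\in\mathbf e$ and $C(x)=C_2(x)$ for $x\notin\mathbf e$, and let $U=SC$ on $\mathcal H$, where $(C\psi)(x)=C(x)\psi(x)$. Let $\sigma_p(U)$ be the set of eigenvalues of $U$ in $\mathcal H$, and let $\sigma_{ess}(U)$ be $\sigma(U)$ without the isolated points of $\sigma(U)$ that are eigenvalues of finite multiplicity. Let $$J_\gamma=\left[\arccos p+\tfrac\gamma2,\ \pi-\arccos p+\tfrac\gamma2\right]\cup\left[\pi+\arccos p+\tfrac\gamma2,\ 2\pi-\arccos p+\tfrac\gamma2\right],$$ let $J_{\gamma,\mathcal T}$ be the set of the four end points of these two intervals, and let $\mathcal T=\{e^{i\theta}\in\sigma_{ess}(U):\theta\in J_{\gamma,\mathcal T}\}$. Then: (1) $\sigma_{ess}(U)=\{e^{i\theta}:\theta\in J_\gamma\}$. (2) $\pm ie^{i\gamma'/2}\in\sigma_p(U)$, and there are associated eigenfunctions $\Psi_\pm\in\mathcal H$ that vanish outside $\mathbf e$. Explicitly, for $y\in\mathbf Z$ let $\psi_{\pm,y}\in\mathcal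 H$ be the function with $$\psi_{\pm,y}(y-1)=\tfrac1{\sqrt2}\begin{pmatrix}\mp ie^{i(\beta'-\gamma'/2)}\\0\end{pmatrix},\qquad\psi_{\pm,y}(y)=\tfrac1{\sqrt2}\begin{pmatrix}0\\1\end{pmatrix},$$ and $\psi_{\pm,y}(x)=0$ for $x\notin\{y-1,y\}$. Then $\|\psi_{\pm,y_j}\|=1$ for each $j$, and for all $\kappa_1,\dots,\kappa_N\in\mathbf C$ the function $\Psi_\pm=\sum_{j=1}^N\kappa_j\psi_{\pm,y_j}$ vanishes outside $\mathbf e$ and satisfies $U\Psi_\pm=\pm ie^{i\gamma'/2}\Psi_\pm$. (3) If $(\gamma'+\pi)/2\in J_\gamma\setminus J_{\gamma,\mathcal T}$, then $\pm ie^{i\gamma'/2}\in\sigma_p(U)\cap(\sigma_{ess}(U)\setminus\mathcal T)$, and every $\Psi\in\mathcal H$ with $U\Psi=\pm ie^{i\gamma'/2}\Psi$ vanishes at all $x\in\mathbf Z$ with $x>x^*$ or $x<x_*$, where $x^*=\max\mathbf e$ and $x_*=\min\mathbf e$. -/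

import Mathlib

noncomputable section

namespace QWalk

/-- The space of states `ℓ²(ℤ; ℂ²)`. -/
abbrev State : Type := lp (fun _ : ℤ => EuclideanSpace ℂ (Fin 2)) 2

/-- Square-summability is the same as summability of the squared norms. -/
theorem memlp_two_iff (f : ℤ → EuclideanSpace ℂ (Fin 2)) :
    Memℓp f 2 ↔ Summable fun x => ‖f x‖ ^ 2 := by
  rw [memℓp_gen_iff (by norm_num)]
  norm_num

theorem hasSum_norm_sq (ψ : State) : HasSum (fun x : ℤ => ‖ψ x‖ ^ 2) (‖ψ‖ ^ 2) := by
  have h := lp.hasSum_norm (p := 2) (by norm_num) ψ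
  norm_num at h
  exact h

theorem norm_eq_of_hasSum (φ ψ : State) (h : HasSum (fun x : ℤ => ‖φ x‖ ^ 2) (‖ψ‖ ^ 2)) :
    ‖φ‖ = ‖ψ‖ := by
  have := (hasSum_norm_sq φ).unique h
  exact (pow_left_inj₀ (norm_nonneg _) (norm_nonneg _) two_ne_zero).1 this

/-- The pointwise shift: the first component at `x` is taken from `x + 1`, the second one from
`x - 1`. -/
def shiftFun (ψ : ℤ → EuclideanSpace ℂ (Fin 2)) (x : ℤ) : EuclideanSpace ℂ (Fin 2) :=
  !₂[ψ (x + 1) 0, ψ (x - 1) 1]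

theorem hasSum_shiftFun (ψ : State) :
    HasSum (fun x : ℤ => ‖shiftFun ψ x‖ ^ 2) (‖ψ‖ ^ 2) := by
  have hs : Summable fun x : ℤ => ‖ψ x‖ ^ 2 := (hasSum_norm_sq ψ).summable
  have e : ∀ x, ‖ψ x‖ ^ 2 = ‖ψ x 0‖ ^ 2 + ‖ψ x 1‖ ^ 2 := fun x => by
    rw [EuclideanSpace.norm_sq_eq, Fin.sum_univ_two]
  have h0 : Summable fun x : ℤ => ‖ψ x 0‖ ^ 2 :=
    hs.of_nonneg_of_le (fun x => by positivity) fun x => by rw [e x]; nlinarith [sq_nonneg ‖ψ x 1‖]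
  have h1 : Summable fun x : ℤ => ‖ψ x 1‖ ^ 2 :=
    hs.of_nonneg_of_le (fun x => by positivity) fun x => by rw [e x]; nlinarith [sq_nonneg ‖ψ x 0‖]
  have t0 := (Equiv.hasSum_iff (Equiv.addRight (1 : ℤ))).2 h0.hasSum
  have t1 := (Equiv.hasSum_iff (Equiv.subRight (1 : ℤ))).2 h1.hasSum
  have hsum : ‖ψ‖ ^ 2 = (∑' x, ‖ψ x 0‖ ^ 2) + ∑' x, ‖ψ x 1‖ ^ 2 := by
    refine (hasSum_norm_sq ψ).unique ?_
    simpa only [e] using h0.hasSum.add h1.hasSum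
  rw [hsum]
  convert t0.add t1 using 2 with x
  simp [shiftFun, EuclideanSpace.norm_sq_eq]

/-- The shift operator `S` on `ℓ²(ℤ; ℂ²)`, as an isometry. -/
def shift : State →ₗᵢ[ℂ] State where
  toFun ψ := ⟨shiftFun ψ, (memlp_two_iff _).2 (hasSum_shiftFun ψ).summable⟩
  map_add' φ ψ := by
    ext x i
    change shiftFun (φ + ψ : State) x i = shiftFun φ x i + shiftFun ψ x i
    fin_cases i <;> simp [shiftFun]
  map_smul' c ψ := by
    ext x i
    change shiftFun (c • ψ : State) x i = c * shiftFun ψ x i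
    fin_cases i <;> simp [shiftFun]
  norm_map' ψ := norm_eq_of_hasSum _ _ (hasSum_shiftFun ψ)

theorem norm_unitary_apply (A : Matrix.unitaryGroup (Fin 2) ℂ) (v : EuclideanSpace ℂ (Fin 2)) :
    ‖Matrix.toEuclideanCLM (n := Fin 2) (𝕜 := ℂ) A.1 v‖ = ‖v‖ :=
  ContinuousLinearMap.norm_map_of_mem_unitary (Unitary.map_mem _ A.2) v

/-- The coin operator: multiplication by the unitary matrix `C x` at each site `x`. -/
def coin (C : ℤ → Matrix.unitaryGroup (Fin 2) ℂ) : State →ₗᵢ[ℂ] State where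
  toFun ψ := ⟨fun x => Matrix.toEuclideanCLM (n := Fin 2) (𝕜 := ℂ) (C x).1 (ψ x),
    (memlp_two_iff _).2 (by
      simp only [norm_unitary_apply]
      exact (hasSum_norm_sq ψ).summable)⟩
  map_add' φ ψ := by
    ext1; funext x
    exact map_add (Matrix.toEuclideanCLM (n := Fin 2) (𝕜 := ℂ) (C x).1) (φ x) (ψ x)
  map_smul' c ψ := by
    ext1; funext x
    exact map_smul (Matrix.toEuclideanCLM (n := Fin 2) (𝕜 := ℂ) (C x).1) c (ψ x)
  norm_map' ψ := norm_eq_of_hasSum _ _ (by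
    convert hasSum_norm_sq ψ using 3 with x
    exact norm_unitary_apply (C x) (ψ x))

/-- The time evolution operator `U = S C` of the walk with coin `C`. -/
def walk (C : ℤ → Matrix.unitaryGroup (Fin 2) ℂ) : State →L[ℂ] State :=
  (shift.comp (coin C)).toContinuousLinearMap

/-- The two components of `U ψ`: with `C x = P x + Q x` split into its two rows, this says
`(U ψ)(x) = P (x + 1) ψ (x + 1) + Q (x - 1) ψ (x - 1)`. -/
theorem walk_apply (C : ℤ → Matrix.unitaryGroup (Fin 2) ℂ) (ψ : State) (x : ℤ) :
    walk C ψ x = !₂[(C (x + 1)).1 0 0 * ψ (x + 1) 0 + (C (x + 1)).1 0 1 * ψ (x + 1) 1,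
      (C (x - 1)).1 1 0 * ψ (x - 1) 0 + (C (x - 1)).1 1 1 * ψ (x - 1) 1] := by
  ext i
  fin_cases i <;>
    simp [walk, shift, coin, shiftFun, Matrix.mulVec, dotProduct, Fin.sum_univ_two,
      Matrix.ofLp_toEuclideanCLM]

/-- The constant coin `C₀` with parameters `p, q, α, β, γ`. -/
def coinZero (p q α β γ : ℝ) : Matrix (Fin 2) (Fin 2) ℂ :=
  Complex.exp (Complex.I * (γ / 2)) •
    !![p * Complex.exp (Complex.I * (α - γ / 2)), q * Complex.exp (Complex.I * (β - γ / 2));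
      -(q * Complex.exp (-(Complex.I * (β - γ / 2)))), p * Complex.exp (-(Complex.I * (α - γ / 2)))]

/-- The anti-diagonal matrix `C₁` with parameters `β', γ'`. -/
def coinOneMatrix (β' γ' : ℝ) : Matrix (Fin 2) (Fin 2) ℂ :=
  Complex.exp (Complex.I * (γ' / 2)) •
    !![0, Complex.exp (Complex.I * (β' - γ' / 2));
      -Complex.exp (-(Complex.I * (β' - γ' / 2))), 0]

theorem coinOneMatrix_mem (β' γ' : ℝ) :
    coinOneMatrix β' γ' ∈ Matrix.unitaryGroup (Fin 2) ℂ := by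
  have h : ∀ t : ℂ, Complex.exp (Complex.I * t) * Complex.exp (-(Complex.I * t)) = 1 := fun t => by
    rw [← Complex.exp_add, add_neg_cancel, Complex.exp_zero]
  have c2 : (starRingEnd ℂ) 2 = 2 := Complex.conj_ofNat 2
  have h1 := h (γ' / 2)
  have h2 := h (β' - γ' / 2)
  rw [Matrix.mem_unitaryGroup_iff]
  ext i j
  fin_cases i <;> fin_cases j <;>
    simp [coinOneMatrix, Matrix.mul_apply, Fin.sum_univ_two, Matrix.star_apply,
      ← Complex.exp_conj, c2]
  · linear_combination (Complex.exp (Complex.I * (β' - γ' / 2)) *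
      Complex.exp (-(Complex.I * (β' - γ' / 2)))) * h1 + h2
  · linear_combination (Complex.exp (Complex.I * (β' - γ' / 2)) *
      Complex.exp (-(Complex.I * (β' - γ' / 2)))) * h1 + h2

/-- The anti-diagonal coin `C₁` as an element of `U(2)`. -/
def coinOne (β' γ' : ℝ) : Matrix.unitaryGroup (Fin 2) ℂ :=
  ⟨coinOneMatrix β' γ', coinOneMatrix_mem β' γ'⟩

/-- The norm `‖A‖_∞ = max |a_{jk}|` on `2 × 2` matrices. -/
def entryMax (A : Matrix (Fin 2) (Fin 2) ℂ) : ℝ :=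
  max (max ‖A 0 0‖ ‖A 0 1‖) (max ‖A 1 0‖ ‖A 1 1‖)

/-- The set `e`, the union of the edges `{y_j - 1, y_j}`. -/
def defectSet {N : ℕ} (y : Fin N → ℤ) : Finset ℤ :=
  Finset.univ.biUnion fun j => {y j - 1, y j}

theorem defectSet_nonempty {N : ℕ} (hN : 0 < N) (y : Fin N → ℤ) : (defectSet y).Nonempty :=
  ⟨y ⟨0, hN⟩, by
    simp only [defectSet, Finset.mem_biUnion, Finset.mem_univ, true_and, Finset.mem_insert,
      Finset.mem_singleton]
    exact ⟨_, Or.inr rfl⟩⟩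

/-- The coin that equals `C₁` on the finite set `e` and `C₂` elsewhere. -/
def defectCoin (e : Finset ℤ) (C₁ : Matrix.unitaryGroup (Fin 2) ℂ)
    (C₂ : ℤ → Matrix.unitaryGroup (Fin 2) ℂ) (x : ℤ) : Matrix.unitaryGroup (Fin 2) ℂ :=
  if x ∈ e then C₁ else C₂ x

/-- The set of eigenvalues of `U` (with eigenvectors in `ℓ²(ℤ; ℂ²)`). -/
def pointSpectrum (U : State →L[ℂ] State) : Set ℂ :=
  {z | Module.End.HasEigenvalue (U : State →ₗ[ℂ] State) z}

/-- The isolated points of the spectrum that are eigenvalues of finite multiplicity. -/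
def discreteSpectrum (U : State →L[ℂ] State) : Set ℂ :=
  {z | z ∈ pointSpectrum U ∧ ¬ AccPt z (Filter.principal (spectrum ℂ U)) ∧
    FiniteDimensional ℂ (Module.End.eigenspace (U : State →ₗ[ℂ] State) z)}

/-- The essential spectrum. -/
def essSpectrum (U : State →L[ℂ] State) : Set ℂ :=
  spectrum ℂ U \ discreteSpectrum U

/-- The set of angles `J_γ`. -/
def arcAngles (p γ : ℝ) : Set ℝ :=
  Set.Icc (Real.arccos p + γ / 2) (Real.pi - Real.arccos p + γ / 2) ∪
    Set.Icc (Real.pi + Real.arccos p + γ / 2) (2 * Real.pi - Real.arccos p + γ / 2)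

/-- The set of threshold angles `J_{γ,𝒯}`. -/
def thresholdAngles (p γ : ℝ) : Set ℝ :=
  {Real.arccos p + γ / 2, Real.pi - Real.arccos p + γ / 2,
    Real.pi + Real.arccos p + γ / 2, 2 * Real.pi - Real.arccos p + γ / 2}

/-- The image `{e^{iθ} ; θ ∈ J}` of a set of angles on the unit circle. -/
def onCircle (J : Set ℝ) : Set ℂ :=
  (fun θ : ℝ => Complex.exp (Complex.I * θ)) '' J

/-- The set of thresholds `𝒯 = {e^{iθ} ∈ σ_ess(U) ; θ ∈ J_{γ,𝒯}}`. -/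
def thresholds (U : State →L[ℂ] State) (p γ : ℝ) : Set ℂ :=
  essSpectrum U ∩ onCircle (thresholdAngles p γ)

/-- The function supported on the edge `{y - 1, y}` with value
`2^{-1/2} (-ε i e^{i(β' - γ'/2)}, 0)` at `y - 1` and `2^{-1/2} (0, 1)` at `y`, for a sign `ε`. -/
def edgeState (β' γ' : ℝ) (ε : ℂ) (y : ℤ) : State :=
  ((1 / Real.sqrt 2 : ℝ) : ℂ) •
    (lp.single 2 (y - 1) !₂[-ε * Complex.I * Complex.exp (Complex.I * (β' - γ' / 2)), 0] +
      lp.single 2 y !₂[0, 1])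

theorem edgeState_apply (β' γ' : ℝ) (ε : ℂ) (y x : ℤ) :
    edgeState β' γ' ε y x = ((1 / Real.sqrt 2 : ℝ) : ℂ) •
      !₂[if x = y - 1 then -ε * Complex.I * Complex.exp (Complex.I * (β' - γ' / 2)) else 0,
        if x = y then 1 else 0] := by
  have h : ∀ (z : ℤ) (a b : ℂ) (i : Fin 2),
      (Pi.single (M := fun _ : ℤ => EuclideanSpace ℂ (Fin 2)) z !₂[a, b] x) i =
        if x = z then !₂[a, b] i else 0 := by
    intro z a b i
    by_cases hx : x = z
    · subst hx; simp
    · simp [hx]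
  ext i
  change ((1 / Real.sqrt 2 : ℝ) : ℂ) * (Pi.single (M := fun _ : ℤ => EuclideanSpace ℂ (Fin 2))
    (y - 1) !₂[-ε * Complex.I * Complex.exp (Complex.I * (β' - γ' / 2)), 0] x i +
      Pi.single (M := fun _ : ℤ => EuclideanSpace ℂ (Fin 2)) y !₂[0, 1] x i) = _
  rw [h, h]
  fin_cases i <;> simp

end QWalk

end

/-!
The essential spectrum is found by comparing `U` with the walk `U₀` of the constant coin `C₀`.
The coins of the two walks differ summably in `x`, so `U - U₀` is a norm convergent sum of finite
rank operators and is compact (`isCompactOperator_walk_sub_walk`).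

By Cayley–Hamilton for the symbol of `U₀`, an approximate solution of `U₀ ψ = z ψ` is one of
`(z² + e^{iγ}) ψ = z T ψ`, where `T` is a combination of two translations with norm at most `2p`.
On the circle `|z² + e^{iγ}| = 2 |cos (θ - γ / 2)|` for `z = e^{iθ}`, so `U₀ - z` is bounded below
off the arcs (`boundedBelow_walk_const`), which are the set `|cos (θ - γ / 2)| ≤ p`
(`mem_onCircle_arcAngles_iff`). Where `U₀ - z` is bounded below, bounded sequences along which
`U - z` tends to zero have convergent subsequences. Together with the orthogonality of eigenvectors
this shows that the spectrum of `U` off the arcs consists of isolated eigenvalues of finite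
multiplicity (`not_accPt_spectrum`, `finiteDimensional_eigenspace`). On the arcs, the symbol has an
eigenvector, and the corresponding plane waves, cut off to `n` sites, have norm of order `√n` while
their images under `U - z` stay bounded (`not_boundedBelow_of_planeWave`). The arcs have no isolated
points, so they belong to the essential spectrum (`essSpectrum_walk`).

On an edge `{y - 1, y}` of the defect, `U` exchanges, up to phases, the first component at `y - 1`
and the second component at `y`, which gives the eigenfunctions on the edges (`walk_edgeState`).

For the vanishing outside the defect, `U ψ = z ψ` is a recursion for the pairs
`(ψ⁽⁰⁾(x - 1), ψ⁽¹⁾(x))` whose transfer matrices converge summably. In the interior of the arcs the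
limit matrix has two distinct eigenvalues of modulus one. Solutions therefore neither grow nor
decay, and the only square summable one is zero (`eq_zero_of_backward_recursion`).
-/

noncomputable section

namespace QWalk

open Filter Topology

/-! ### Weyl's theorem for unitary operators -/

section OperatorTheory

variable {H : Type*} [NormedAddCommGroup H] [InnerProductSpace ℂ H]

/-- `A` is bounded below: `‖A ψ‖` dominates a positive multiple of `‖ψ‖`. -/
def BoundedBelow (A : H →L[ℂ] H) : Prop :=
  ∃ c > (0 : ℝ), ∀ ψ, c * ‖ψ‖ ≤ ‖A ψ‖

theorem BoundedBelow.of_notMem_spectrum {U : H →L[ℂ] H} {z : ℂ} (hz : z ∉ spectrum ℂ U) :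
    BoundedBelow (U - z • ContinuousLinearMap.id ℂ H) := by
  rw [spectrum.notMem_iff] at hz
  obtain ⟨V, hV⟩ := hz.exists_left_inv
  refine ⟨(‖V‖ + 1)⁻¹, by positivity, fun ψ => ?_⟩
  have h : ψ = -V ((U - z • ContinuousLinearMap.id ℂ H) ψ) := by
    have := congrArg (fun A : H →L[ℂ] H => A ψ) hV
    simp only [mul_apply_eq_comp, one_apply_eq_self, sub_apply,
      Algebra.algebraMap_eq_smul_one, smul_apply] at this
    rw [← map_neg]
    simpa using this.symm
  rw [inv_mul_le_iff₀ (by positivity)]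
  calc ‖ψ‖ = ‖V ((U - z • ContinuousLinearMap.id ℂ H) ψ)‖ := by
        conv_lhs => rw [h]
        rw [norm_neg]
    _ ≤ ‖V‖ * ‖(U - z • ContinuousLinearMap.id ℂ H) ψ‖ := V.le_opNorm _
    _ ≤ _ := by gcongr; linarith

theorem inner_eq_zero_of_eigenvectors {U : H →L[ℂ] H}
    (hU : ∀ φ ψ : H, inner ℂ (U φ) (U ψ) = inner ℂ φ ψ) {z w : ℂ} (hz : ‖z‖ = 1)
    (hzw : w ≠ z) {φ ψ : H} (hφ : U φ = z • φ) (hψ : U ψ = w • ψ) :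
    inner ℂ φ ψ = 0 := by
  have h := hU φ ψ
  rw [hφ, hψ, inner_smul_left, inner_smul_right] at h
  have h1 : z * (starRingEnd ℂ) z = 1 := by
    rw [Complex.mul_conj, Complex.normSq_eq_norm_sq, hz]; norm_num
  have h2 : (w - z) * inner ℂ φ ψ = 0 := by
    linear_combination z * h - w * inner ℂ φ ψ * h1
  exact (mul_eq_zero.1 h2).resolve_left (sub_ne_zero.2 hzw)

variable [CompleteSpace H]

/-- For a unitary operator `U`, the normal operator `U - z` has dense range as soon as it is
injective, hence is invertible as soon as it is bounded below. -/
theorem notMem_spectrum_of_boundedBelow {U : H →L[ℂ] H} (hU : U ∈ unitary (H →L[ℂ] H)) {z : ℂ}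
    (hz : BoundedBelow (U - z • ContinuousLinearMap.id ℂ H)) : z ∉ spectrum ℂ U := by
  obtain ⟨c, hc, h⟩ := hz
  set A : H →L[ℂ] H := U - z • ContinuousLinearMap.id ℂ H with hA
  have hUn : IsStarNormal U := isStarNormal_of_mem_unitary hU
  have hn : IsStarNormal A := by
    refine ⟨?_⟩
    have e : A = U - z • (1 : H →L[ℂ] H) := rfl
    have h1 : star U * U = U * star U := hUn.star_comm_self
    rw [e, Commute, SemiconjBy]
    simp only [star_sub, star_smul, star_one, sub_mul, mul_sub, smul_mul_assoc, mul_smul_comm,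
      one_mul, mul_one, h1]
    rw [smul_sub, smul_sub, smul_comm]
    abel
  have hker : A.ker = ⊥ := by
    rw [LinearMap.ker_eq_bot']
    intro ψ hψ
    have := h ψ
    rw [show A ψ = 0 from hψ, norm_zero] at this
    exact norm_le_zero_iff.1 (by nlinarith)
  have hunit : IsUnit A := by
    rw [ContinuousLinearMap.isUnit_iff_bijective,
      ContinuousLinearMap.bijective_iff_dense_range_and_antilipschitz]
    refine ⟨?_, ⟨c⁻¹, by positivity⟩, ?_⟩
    · rw [← Submodule.orthogonal_eq_bot_iff, Submodule.orthogonal_closure,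
        ContinuousLinearMap.IsStarNormal.orthogonal_range hn, hker]
    · refine AddMonoidHomClass.antilipschitz_of_bound A fun ψ => ?_
      change ‖ψ‖ ≤ c⁻¹ * ‖A ψ‖
      rw [le_inv_mul_iff₀ hc]
      exact h ψ
  rw [spectrum.notMem_iff]
  have e : algebraMap ℂ (H →L[ℂ] H) z - U = -A := by
    rw [hA, Algebra.algebraMap_eq_smul_one]
    change z • (1 : H →L[ℂ] H) - U = -(U - z • (1 : H →L[ℂ] H))
    abel
  rw [e]
  exact hunit.neg

theorem exists_approximate_eigenvectors {U : H →L[ℂ] H} (hU : U ∈ unitary (H →L[ℂ] H)) {z : ℂ}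
    (hz : z ∈ spectrum ℂ U) :
    ∃ ψ : ℕ → H, (∀ n, ‖ψ n‖ = 1) ∧ Tendsto (fun n => U (ψ n) - z • ψ n) atTop (𝓝 0) := by
  have h : ¬ BoundedBelow (U - z • ContinuousLinearMap.id ℂ H) :=
    fun h => notMem_spectrum_of_boundedBelow hU h hz
  have h' : ∀ n : ℕ, ∃ ψ : H, ‖ψ‖ = 1 ∧ ‖U ψ - z • ψ‖ ≤ 1 / ((n : ℝ) + 1) := by
    intro n
    unfold BoundedBelow at h
    push Not at h
    obtain ⟨ψ, hψ⟩ := h (1 / ((n : ℝ) + 1)) (by positivity)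
    have h0 : 0 < ‖ψ‖ := by
      by_contra h0
      have : ψ = 0 := norm_le_zero_iff.1 (not_lt.1 h0)
      simp [this] at hψ
    refine ⟨((‖ψ‖⁻¹ : ℝ) : ℂ) • ψ, ?_, ?_⟩
    · rw [norm_smul, Complex.norm_real, norm_inv, norm_norm, inv_mul_cancel₀ h0.ne']
    · rw [map_smul, smul_comm z, ← smul_sub, norm_smul, Complex.norm_real, norm_inv, norm_norm,
        inv_mul_le_iff₀ h0, mul_comm]
      exact hψ.le
  choose ψ h1 h2 using h'
  exact ⟨ψ, h1, squeeze_zero_norm h2 tendsto_one_div_add_atTop_nhds_zero_nat⟩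

/-- If `U - U₀` is compact and `U₀ - z` is bounded below, then `U - z` is proper on bounded
sets: a bounded sequence along which `U - z` tends to zero has a convergent subsequence. -/
theorem exists_convergent_subsequence {U U₀ : H →L[ℂ] H} (hK : IsCompactOperator (U - U₀)) {z : ℂ}
    (hz : BoundedBelow (U₀ - z • ContinuousLinearMap.id ℂ H)) {ψ : ℕ → H}
    (hψ : ∀ n, ‖ψ n‖ ≤ 1) (hlim : Tendsto (fun n => U (ψ n) - z • ψ n) atTop (𝓝 0)) :
    ∃ φ : H, ∃ s : ℕ → ℕ, StrictMono s ∧ Tendsto (ψ ∘ s) atTop (𝓝 φ) := by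
  obtain ⟨c, hc, hb⟩ := hz
  set A : H →L[ℂ] H := U₀ - z • ContinuousLinearMap.id ℂ H with hA
  have hcomp := IsCompactOperator.isCompact_closure_image_closedBall
    (f := ((U - U₀ : H →L[ℂ] H) : H →ₗ[ℂ] H)) hK 1
  obtain ⟨χ, -, s, hs, hχ⟩ := hcomp.tendsto_subseq (x := fun n => (U - U₀) (ψ n)) fun n =>
    subset_closure ⟨ψ n, by simpa using hψ n, rfl⟩
  have hAlim : Tendsto (fun n => A (ψ (s n))) atTop (𝓝 (0 - χ)) := by
    refine ((hlim.comp hs.tendsto_atTop).sub hχ).congr fun n => ?_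
    simp only [Function.comp, hA, sub_apply, smul_apply,
      ContinuousLinearMap.id_apply]
    abel
  have hanti : AntilipschitzWith ⟨c⁻¹, by positivity⟩ A := by
    refine AddMonoidHomClass.antilipschitz_of_bound A fun ψ => ?_
    change ‖ψ‖ ≤ c⁻¹ * ‖A ψ‖
    rw [le_inv_mul_iff₀ hc]
    exact hb ψ
  have hcauchy : CauchySeq (ψ ∘ s) := by
    have := hAlim.cauchySeq
    exact (hanti.isUniformInducing A.uniformContinuous).cauchy_map_iff.1 this
  obtain ⟨φ, hφ⟩ := cauchySeq_tendsto_of_complete hcauchy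
  exact ⟨φ, s, hs, hφ⟩

theorem exists_eigenvector {U U₀ : H →L[ℂ] H} (hU : U ∈ unitary (H →L[ℂ] H))
    (hK : IsCompactOperator (U - U₀)) {z : ℂ}
    (hz : BoundedBelow (U₀ - z • ContinuousLinearMap.id ℂ H)) (hzσ : z ∈ spectrum ℂ U) :
    ∃ φ : H, ‖φ‖ = 1 ∧ U φ = z • φ := by
  obtain ⟨ψ, h1, hlim⟩ := exists_approximate_eigenvectors hU hzσ
  obtain ⟨φ, s, hs, hφ⟩ := exists_convergent_subsequence hK hz (fun n => (h1 n).le) hlim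
  refine ⟨φ, ?_, ?_⟩
  · refine tendsto_nhds_unique hφ.norm ?_
    simp [Function.comp, h1]
  · have h2 : Tendsto (fun n => U (ψ (s n)) - z • ψ (s n)) atTop (𝓝 (U φ - z • φ)) :=
      ((U.continuous.tendsto φ).comp hφ).sub (hφ.const_smul z)
    exact sub_eq_zero.1 (tendsto_nhds_unique h2 (hlim.comp hs.tendsto_atTop))

theorem finiteDimensional_eigenspace {U U₀ : H →L[ℂ] H} (hK : IsCompactOperator (U - U₀)) {z : ℂ}
    (hz : BoundedBelow (U₀ - z • ContinuousLinearMap.id ℂ H)) :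
    FiniteDimensional ℂ (Module.End.eigenspace (U : H →ₗ[ℂ] H) z) := by
  refine FiniteDimensional.of_isCompact_closedBall₀ ℂ zero_lt_one ?_
  refine IsSeqCompact.isCompact fun ψ hψ => ?_
  have hU : ∀ n, U (ψ n) = z • (ψ n : H) := fun n => Module.End.mem_eigenspace_iff.1 (ψ n).2
  obtain ⟨φ, s, hs, hφ⟩ := exists_convergent_subsequence hK hz (ψ := fun n => (ψ n : H))
    (fun n => by simpa using hψ n) (by simp [hU])
  have hφm : φ ∈ Module.End.eigenspace (U : H →ₗ[ℂ] H) z := by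
    rw [Module.End.mem_eigenspace_iff]
    refine tendsto_nhds_unique ((U.continuous.tendsto φ).comp hφ) ?_
    simpa [Function.comp_def, hU] using hφ.const_smul z
  have hlim : Tendsto (ψ ∘ s) atTop (𝓝 ⟨φ, hφm⟩) := tendsto_subtype_rng.2 hφ
  exact ⟨⟨φ, hφm⟩, Metric.isClosed_closedBall.mem_of_tendsto hlim
    (Eventually.of_forall fun n => hψ (s n)), s, hs, hlim⟩

/-- Eigenvectors to eigenvalues that accumulate at `z` would have a subsequence converging to a
unit eigenvector for `z`, to which all of them are orthogonal. -/
theorem not_accPt_spectrum {U U₀ : H →L[ℂ] H} (hU : U ∈ unitary (H →L[ℂ] H))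
    (hK : IsCompactOperator (U - U₀)) {z : ℂ}
    (hz : ∀ᶠ w in 𝓝 z, BoundedBelow (U₀ - w • ContinuousLinearMap.id ℂ H))
    (hz1 : ‖z‖ = 1) : ¬ AccPt z (𝓟 (spectrum ℂ U)) := by
  intro hacc
  rw [accPt_iff_frequently] at hacc
  obtain ⟨w, hw, hwf⟩ := exists_seq_forall_of_frequently (hacc.and_eventually hz)
  choose ψ hψ1 hψ using fun n => exists_eigenvector hU hK (hwf n).2 (hwf n).1.2
  have hlim : Tendsto (fun n => U (ψ n) - z • ψ n) atTop (𝓝 0) := by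
    have h : Tendsto (fun n => ‖w n - z‖) atTop (𝓝 0) := by
      simpa using (hw.sub_const z).norm
    refine squeeze_zero_norm (fun n => ?_) h
    rw [hψ n, ← sub_smul, norm_smul, hψ1 n, mul_one]
  obtain ⟨φ, s, hs, hφ⟩ := exists_convergent_subsequence hK hz.self_of_nhds
    (fun n => (hψ1 n).le) hlim
  have hφ1 : ‖φ‖ = 1 := by
    refine tendsto_nhds_unique hφ.norm ?_
    simp [Function.comp, hψ1]
  have hφU : U φ = z • φ := by
    have h2 : Tendsto (fun n => U (ψ (s n)) - z • ψ (s n)) atTop (𝓝 (U φ - z • φ)) :=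
      ((U.continuous.tendsto φ).comp hφ).sub (hφ.const_smul z)
    exact sub_eq_zero.1 (tendsto_nhds_unique h2 (hlim.comp hs.tendsto_atTop))
  have horth : ∀ n, inner ℂ φ (ψ (s n)) = 0 := fun n =>
    inner_eq_zero_of_eigenvectors (ContinuousLinearMap.inner_map_map_of_mem_unitary hU) hz1
      (hwf (s n)).1.1 hφU (hψ (s n))
  have h0 : inner ℂ φ φ = 0 := by
    have := (tendsto_const_nhds (x := φ)).inner (𝕜 := ℂ) hφ
    refine tendsto_nhds_unique this ?_
    simp [Function.comp, horth]
  rw [inner_self_eq_zero] at h0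
  simp [h0] at hφ1

end OperatorTheory

/-! ### Recursions with summable perturbations -/

section Asymptotics

/-- A backward recursion `u n = L (u (n + 1)) + r n`, with `L` diagonalizable with two distinct
eigenvalues of modulus one and a relatively summable error `r`, has no nonzero solution that tends
to zero: in the norm `‖(L - ν) u‖ + ‖(L - μ) u‖`, for which `L` is an isometry, a step backwards
increases `u` by a factor of at most `1 + K ε n`, and the product of these factors converges. -/
theorem eq_zero_of_backward_recursion {E : Type*} [NormedAddCommGroup E] [NormedSpace ℂ E]
    (L : E →L[ℂ] E) {μ ν : ℂ} (hμ : ‖μ‖ = 1) (hν : ‖ν‖ = 1) (hμν : μ ≠ ν)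
    (hL : ∀ v, L (L v) = (μ + ν) • L v - (μ * ν) • v) {u : ℕ → E} {ε : ℕ → ℝ} (hε : Summable ε)
    (hu : ∀ n, ‖u n - L (u (n + 1))‖ ≤ ε n * ‖u (n + 1)‖) (hlim : Tendsto u atTop (𝓝 0)) (n : ℕ) :
    u n = 0 := by
  set F : E → ℝ := fun v => ‖L v - ν • v‖ + ‖L v - μ • v‖ with hF
  have hgap : 0 < ‖μ - ν‖ := norm_pos_iff.2 (sub_ne_zero.2 hμν)
  have hFL : ∀ v, F (L v) = F v := fun v => by
    have h1 : L (L v) - ν • L v = μ • (L v - ν • v) := by rw [hL]; module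
    have h2 : L (L v) - μ • L v = ν • (L v - μ • v) := by rw [hL]; module
    simp only [hF, h1, h2, norm_smul, hμ, hν, one_mul]
  have hFadd : ∀ v w, F (v + w) ≤ F v + F w := fun v w => by
    have h : ∀ κ : ℂ, ‖L (v + w) - κ • (v + w)‖ ≤ ‖L v - κ • v‖ + ‖L w - κ • w‖ := fun κ => by
      refine le_trans (le_of_eq ?_) (norm_add_le _ _)
      rw [map_add]
      congr 1
      module
    have := h ν
    have := h μ
    simp only [hF]
    linarith
  have hFlow : ∀ v, ‖μ - ν‖ * ‖v‖ ≤ F v := fun v => by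
    rw [← norm_smul]
    refine le_trans (le_of_eq ?_) (norm_sub_le _ _)
    congr 1
    module
  have hFup : ∀ v, F v ≤ 2 * (‖L‖ + 1) * ‖v‖ := fun v => by
    have h : ∀ κ : ℂ, ‖κ‖ = 1 → ‖L v - κ • v‖ ≤ (‖L‖ + 1) * ‖v‖ := fun κ hκ => by
      refine (norm_sub_le _ _).trans ?_
      rw [norm_smul, hκ, add_mul]
      gcongr
      exact L.le_opNorm v
    have := h ν hν
    have := h μ hμ
    simp only [hF]
    linarith
  have hε0 : ∀ n, 0 ≤ ε n ∨ u (n + 1) = 0 := fun n => by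
    rcases eq_or_ne (u (n + 1)) 0 with h | h
    · exact Or.inr h
    · exact Or.inl (nonneg_of_mul_nonneg_left ((norm_nonneg _).trans (hu n)) (norm_pos_iff.2 h))
  set K : ℝ := 2 * (‖L‖ + 1) / ‖μ - ν‖ with hK
  have hK0 : 0 ≤ K := by positivity
  have hFzero : F 0 = 0 := by simp [hF]
  have hstep : ∀ n, F (u n) ≤ Real.exp (K * ε n) * F (u (n + 1)) := fun n => by
    rcases hε0 n with h0 | h0
    · have h1 : F (u n) ≤ F (u (n + 1)) + 2 * (‖L‖ + 1) * (ε n * ‖u (n + 1)‖) := by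
        calc F (u n) = F (L (u (n + 1)) + (u n - L (u (n + 1)))) := by congr 1; abel
          _ ≤ F (L (u (n + 1))) + F (u n - L (u (n + 1))) := hFadd _ _
          _ ≤ _ := by
            rw [hFL]
            gcongr
            exact (hFup _).trans (by gcongr; exact hu n)
      have h2 : 2 * (‖L‖ + 1) * (ε n * ‖u (n + 1)‖) ≤ K * ε n * F (u (n + 1)) := by
        have h3 : 2 * (‖L‖ + 1) * (ε n * ‖u (n + 1)‖) = K * ε n * (‖μ - ν‖ * ‖u (n + 1)‖) := by
          rw [hK]; field_simp
        rw [h3]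
        exact mul_le_mul_of_nonneg_left (hFlow _) (by positivity)
      have h4 : 0 ≤ F (u (n + 1)) := by positivity
      calc F (u n) ≤ (K * ε n + 1) * F (u (n + 1)) := by linarith
        _ ≤ _ := by gcongr; exact Real.add_one_le_exp _
    · have h1 : u n = 0 := by
        have := hu n
        rw [h0] at this
        simpa using this
      simp [h0, h1, hFzero]
  set g : ℕ → ℝ := fun n => Real.exp (K * ∑ i ∈ Finset.range n, ε i) * F (u n) with hg
  have hmono : Monotone g := monotone_nat_of_le_succ fun n => by
    change Real.exp _ * F (u n) ≤ Real.exp _ * F (u (n + 1))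
    rw [Finset.sum_range_succ, mul_add K, Real.exp_add, mul_assoc]
    exact mul_le_mul_of_nonneg_left (hstep n) (Real.exp_nonneg _)
  have hFcont : Continuous F := by
    have := L.continuous
    fun_prop
  have hglim : Tendsto g atTop (𝓝 0) := by
    have h1 : Tendsto (fun n => F (u n)) atTop (𝓝 0) := by
      simpa [hFzero, Function.comp_def] using (hFcont.tendsto 0).comp hlim
    have h2 := (Real.continuous_exp.tendsto _).comp (hε.hasSum.tendsto_sum_nat.const_mul K)
    simpa [Function.comp_def] using h2.mul h1
  have h1 : F (u n) ≤ 0 := by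
    have := hmono.ge_of_tendsto hglim n
    exact nonpos_of_mul_nonpos_right this (Real.exp_pos _)
  have h2 := (hFlow (u n)).trans h1
  exact norm_le_zero_iff.1 (nonpos_of_mul_nonpos_right h2 hgap)

/-- Solutions, on a half-line, of the eigenvalue equation of a walk whose coins `A n, B n, C n, D n`
converge summably to `a, b, c, d`. The roots `μ, ν` are the eigenvalues of the limit of the
inverse transfer matrices that take `(s (n + 1), t (n + 1))` to `(s n, t n)`. -/
theorem eq_zero_of_halfLine_solution {z a b c d μ ν : ℂ} (hz : ‖z‖ = 1) (hd : d ≠ 0)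
    (hμ : ‖μ‖ = 1) (hν : ‖ν‖ = 1) (hμν : μ ≠ ν)
    (htr : z ^ 2 + (a * d - b * c) = z * d * (μ + ν)) (hdet : d * (μ * ν) = a)
    {A B C D : ℕ → ℂ} {δ : ℝ} (hδ : 0 < δ) (hD : ∀ n, δ ≤ ‖D n‖) (hC : ∀ n, ‖C n‖ ≤ 1)
    {ε : ℕ → ℝ} (hε : Summable ε) (hAa : ∀ n, ‖A n - a‖ ≤ ε n) (hBb : ∀ n, ‖B n - b‖ ≤ ε n)
    (hCc : ∀ n, ‖C n - c‖ ≤ ε n) (hDd : ∀ n, ‖D n - d‖ ≤ ε n) {s t : ℕ → ℂ}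
    (hst : ∀ n, z * s n = A n * s (n + 1) + B n * t n)
    (hts : ∀ n, z * t (n + 1) = C n * s (n + 1) + D n * t n)
    (hs : Tendsto s atTop (𝓝 0)) (ht : Tendsto t atTop (𝓝 0)) (n : ℕ) : s n = 0 ∧ t n = 0 := by
  have hz0 : z ≠ 0 := norm_pos_iff.1 (by rw [hz]; norm_num)
  let fst := ContinuousLinearMap.fst ℂ ℂ ℂ
  let snd := ContinuousLinearMap.snd ℂ ℂ ℂ
  let L : ℂ × ℂ →L[ℂ] ℂ × ℂ :=
    ((((a * d - b * c) / (d * z)) • fst + (b / d) • snd)).prod ((-c / d) • fst + (z / d) • snd)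
  have hLv : ∀ v, L v = (((a * d - b * c) / (d * z)) * v.1 + (b / d) * v.2,
      (-c / d) * v.1 + (z / d) * v.2) := fun v => rfl
  have hL : ∀ v, L (L v) = (μ + ν) • L v - (μ * ν) • v := fun v => by
    have e1 : μ + ν = (z ^ 2 + (a * d - b * c)) / (z * d) := by
      rw [htr]; field_simp
    have e2 : μ * ν = a / d := by rw [← hdet]; field_simp
    rw [e1, e2]
    simp only [hLv]
    ext
    · simp only [Prod.smul_fst, Prod.fst_sub, smul_eq_mul]
      field_simp
      ring
    · simp only [Prod.smul_snd, Prod.snd_sub, smul_eq_mul]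
      field_simp
      ring
  have hd0 : 0 < ‖d‖ := norm_pos_iff.2 hd
  set κ : ℝ := (1 + 2 / δ) * (1 + (1 + ‖b‖) / ‖d‖) with hκ
  have key : ∀ n, ‖(s n, t n) - L (s (n + 1), t (n + 1))‖
      ≤ κ * ε n * ‖(s (n + 1), t (n + 1))‖ := fun n => by
    set m : ℝ := ‖(s (n + 1), t (n + 1))‖ with hm
    have hsm : ‖s (n + 1)‖ ≤ m := norm_fst_le (s (n + 1), t (n + 1))
    have htm : ‖t (n + 1)‖ ≤ m := norm_snd_le (s (n + 1), t (n + 1))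
    have hε0 : 0 ≤ ε n := (norm_nonneg _).trans (hAa n)
    have hm0 : 0 ≤ m := norm_nonneg _
    have htn : ‖t n‖ ≤ 2 / δ * m := by
      have h1 : D n * t n = z * t (n + 1) - C n * s (n + 1) := by linear_combination -hts n
      have h2 : ‖D n‖ * ‖t n‖ ≤ m + m := by
        rw [← norm_mul, h1]
        refine (norm_sub_le _ _).trans ?_
        rw [norm_mul, norm_mul, hz, one_mul]
        have := mul_le_mul (hC n) hsm (norm_nonneg _) zero_le_one
        linarith
      have h3 : δ * ‖t n‖ ≤ m + m :=
        (mul_le_mul_of_nonneg_right (hD n) (norm_nonneg _)).trans h2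
      rw [div_mul_eq_mul_div, le_div_iff₀ hδ]
      linarith
    set τ := t n - (-c / d * s (n + 1) + z / d * t (n + 1)) with hτ
    have hτe : d * τ = -((D n - d) * t n + (C n - c) * s (n + 1)) := by
      rw [hτ]
      have := hts n
      field_simp
      linear_combination -this
    have hτn : ‖τ‖ ≤ ε n * ((1 + 2 / δ) * m) / ‖d‖ := by
      rw [le_div_iff₀ hd0, mul_comm, ← norm_mul, hτe, norm_neg]
      refine (norm_add_le _ _).trans ?_
      rw [norm_mul, norm_mul]
      have h1 := mul_le_mul (hDd n) htn (norm_nonneg _) hε0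
      have h2 := mul_le_mul (hCc n) hsm (norm_nonneg _) hε0
      linarith
    have hσe : s n - ((a * d - b * c) / (d * z) * s (n + 1) + b / d * t (n + 1)) =
        z⁻¹ * ((A n - a) * s (n + 1) + (B n - b) * t n + b * τ) := by
      rw [hτ]
      have := hst n
      field_simp
      linear_combination d * this
    have hσn : ‖s n - ((a * d - b * c) / (d * z) * s (n + 1) + b / d * t (n + 1))‖ ≤
        ε n * ((1 + 2 / δ) * m) + ‖b‖ * (ε n * ((1 + 2 / δ) * m) / ‖d‖) := by
      rw [hσe, norm_mul, norm_inv, hz, inv_one, one_mul]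
      refine (norm_add₃_le).trans ?_
      rw [norm_mul, norm_mul, norm_mul]
      have h1 := mul_le_mul (hAa n) hsm (norm_nonneg _) hε0
      have h2 := mul_le_mul (hBb n) htn (norm_nonneg _) hε0
      have h3 := mul_le_mul_of_nonneg_left hτn (norm_nonneg b)
      linarith
    have hW : 0 ≤ ε n * ((1 + 2 / δ) * m) := by positivity
    have hκe : κ * ε n * m = ε n * ((1 + 2 / δ) * m) + ε n * ((1 + 2 / δ) * m) / ‖d‖ +
        ‖b‖ * (ε n * ((1 + 2 / δ) * m) / ‖d‖) := by
      rw [hκ]; field_simp; ring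
    have hW1 : 0 ≤ ε n * ((1 + 2 / δ) * m) / ‖d‖ := by positivity
    have hW2 : 0 ≤ ‖b‖ * (ε n * ((1 + 2 / δ) * m) / ‖d‖) := by positivity
    rw [hLv, hκe]
    refine max_le ?_ ?_
    · exact hσn.trans (by linarith)
    · exact hτn.trans (by linarith)
  have h := eq_zero_of_backward_recursion L hμ hν hμν hL (u := fun n => (s n, t n))
    (hε.mul_left κ) key (hs.prodMk_nhds ht) n
  exact Prod.ext_iff.1 h

end Asymptotics

/-! ### Unitarity of the walk -/

section Unitarity

theorem coin_apply (C : ℤ → Matrix.unitaryGroup (Fin 2) ℂ) (ψ : State) (x : ℤ) :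
    coin C ψ x = Matrix.toEuclideanCLM (n := Fin 2) (𝕜 := ℂ) (C x).1 (ψ x) := rfl

theorem coin_surjective (C : ℤ → Matrix.unitaryGroup (Fin 2) ℂ) :
    Function.Surjective (coin C) := fun φ => by
  refine ⟨coin (fun x => (C x)⁻¹) φ, ?_⟩
  ext1; funext x
  have h : (C x).1 * ((C x)⁻¹).1 = 1 := congrArg Subtype.val (mul_inv_cancel (C x))
  rw [coin_apply, coin_apply, ← ContinuousLinearMap.comp_apply]
  change (Matrix.toEuclideanCLM (n := Fin 2) (𝕜 := ℂ) (C x).1 *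
    Matrix.toEuclideanCLM (n := Fin 2) (𝕜 := ℂ) ((C x)⁻¹).1) (φ x) = φ x
  rw [← map_mul, h, map_one, one_apply_eq_self]

/-- The walk with the constant antidiagonal coin `(0, 1; -1, 0)` squares to `-1`. Hence `S` has the
right inverse `-C S C`, where `C` is that coin. -/
theorem shift_surjective : Function.Surjective shift := fun φ => by
  refine ⟨coin (fun _ => coinOne 0 0) (walk (fun _ => coinOne 0 0) (-φ)), ?_⟩
  change walk (fun _ => coinOne 0 0) (walk (fun _ => coinOne 0 0) (-φ)) = φ
  ext x i
  fin_cases i <;> simp [walk_apply, coinOne, coinOneMatrix]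

theorem walk_mem_unitary (C : ℤ → Matrix.unitaryGroup (Fin 2) ℂ) :
    walk C ∈ unitary (State →L[ℂ] State) := by
  have hs : Function.Surjective (walk C) := shift_surjective.comp (coin_surjective C)
  have h1 : star (walk C) * walk C = 1 :=
    (ContinuousLinearMap.norm_map_iff_adjoint_comp_self (walk C)).1
      (shift.comp (coin C)).norm_map
  refine Unitary.mem_iff.2 ⟨h1, ?_⟩
  refine ContinuousLinearMap.ext fun φ => ?_
  obtain ⟨ψ, rfl⟩ := hs φ
  change walk C ((star (walk C) * walk C) ψ) = walk C ψ
  rw [h1, one_apply_eq_self]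

end Unitarity

/-! ### Eigenfunctions supported on an edge -/

section EdgeStates

theorem walk_edgeState {C : ℤ → Matrix.unitaryGroup (Fin 2) ℂ} {β' γ' : ℝ} {y : ℤ}
    (h0 : C (y - 1) = coinOne β' γ') (h1 : C y = coinOne β' γ') {ε : ℂ} (hε : ε = 1 ∨ ε = -1) :
    walk C (edgeState β' γ' ε y) =
      (ε * Complex.I * Complex.exp (Complex.I * (γ' / 2))) • edgeState β' γ' ε y := by
  have hε2 : ε * ε = 1 := by rcases hε with rfl | rfl <;> norm_num
  have he : Complex.exp (Complex.I * (β' - γ' / 2)) *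
      Complex.exp (-(Complex.I * (β' - γ' / 2))) = 1 := by
    rw [← Complex.exp_add, add_neg_cancel, Complex.exp_zero]
  ext x i
  rw [walk_apply, lp.coeFn_smul, Pi.smul_apply]
  fin_cases i
  · by_cases hx : x = y - 1
    · subst hx
      simp [edgeState_apply, h1, coinOne, coinOneMatrix]
      linear_combination (Complex.exp (Complex.I * (γ' / 2)) *
        Complex.exp (Complex.I * (β' - γ' / 2)) * (Real.sqrt 2 : ℂ)⁻¹) * Complex.I ^ 2 * hε2 +
        (Complex.exp (Complex.I * (γ' / 2)) *
        Complex.exp (Complex.I * (β' - γ' / 2)) * (Real.sqrt 2 : ℂ)⁻¹) * Complex.I_sq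
    · have hx' : x + 1 ≠ y := fun h => hx (by omega)
      by_cases hx2 : x + 1 = y - 1
      · simp [edgeState_apply, hx, hx2, h0, coinOne, coinOneMatrix]
      · simp [edgeState_apply, hx, hx', hx2]
  · by_cases hx : x = y
    · subst hx
      simp [edgeState_apply, h0, coinOne, coinOneMatrix]
      linear_combination (Complex.exp (Complex.I * (γ' / 2)) * ε * Complex.I *
        (Real.sqrt 2 : ℂ)⁻¹) * he
    · by_cases hx2 : x - 1 = y
      · have hy : y ≠ y - 1 := by omega
        simp [edgeState_apply, hx, hx2, hy, h1, coinOne, coinOneMatrix]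
      · simp [edgeState_apply, hx, hx2]

theorem norm_edgeState (β' γ' : ℝ) {ε : ℂ} (hε : ε = 1 ∨ ε = -1) (y : ℤ) :
    ‖edgeState β' γ' ε y‖ = 1 := by
  have hε1 : ‖ε‖ = 1 := by rcases hε with rfl | rfl <;> simp
  have he : ‖Complex.exp (Complex.I * (β' - γ' / 2))‖ = 1 := by
    rw [mul_comm]
    have := Complex.norm_exp_ofReal_mul_I (β' - γ' / 2)
    push_cast at this
    exact this
  have h : HasSum (fun x : ℤ => ‖edgeState β' γ' ε y x‖ ^ 2)
      (∑ x ∈ {y - 1, y}, ‖edgeState β' γ' ε y x‖ ^ 2) := by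
    refine hasSum_sum_of_ne_finset_zero fun x hx => ?_
    simp only [Finset.mem_insert, Finset.mem_singleton, not_or] at hx
    simp [edgeState_apply, hx.1, hx.2, EuclideanSpace.norm_sq_eq]
  have h1 : ‖edgeState β' γ' ε y‖ ^ 2 = 1 := by
    have hy : y ≠ y - 1 := by omega
    rw [(hasSum_norm_sq _).unique h, Finset.sum_pair hy.symm, EuclideanSpace.norm_sq_eq,
      EuclideanSpace.norm_sq_eq, Fin.sum_univ_two, Fin.sum_univ_two]
    simp [edgeState_apply, hε1, he, hy]
    norm_num
  exact (pow_eq_one_iff_of_nonneg (norm_nonneg _) two_ne_zero).1 h1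

theorem edgeState_apply_of_notMem {β' γ' : ℝ} {ε : ℂ} {y x : ℤ} (h0 : x ≠ y - 1) (h1 : x ≠ y) :
    edgeState β' γ' ε y x = 0 := by
  rw [edgeState_apply, if_neg h0, if_neg h1]
  ext i
  fin_cases i <;> simp

end EdgeStates

/-! ### Compactness of the perturbation -/

section Perturbation

theorem single_apply_apply (z : ℤ) (v : EuclideanSpace ℂ (Fin 2)) (x : ℤ) (i : Fin 2) :
    (lp.single 2 z v : State) x i = if x = z then v i else 0 := by
  rw [lp.single_apply]
  by_cases hx : x = z
  · subst hx; simp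
  · simp [hx]

/-- The operator norm of the difference of two coins at the site `x`. -/
def coinDist (C C' : ℤ → Matrix.unitaryGroup (Fin 2) ℂ) (x : ℤ) : ℝ :=
  ‖Matrix.toEuclideanCLM (n := Fin 2) (𝕜 := ℂ) ((C x).1 - (C' x).1)‖

theorem norm_walk_sub_walk_single_le (C C' : ℤ → Matrix.unitaryGroup (Fin 2) ℂ) (x : ℤ)
    (v : EuclideanSpace ℂ (Fin 2)) :
    ‖(walk C - walk C') (lp.single 2 x v)‖ ≤ coinDist C C' x * ‖v‖ := by
  have h1 : (walk C - walk C') (lp.single 2 x v) = shift (lp.single 2 x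
      (Matrix.toEuclideanCLM (n := Fin 2) (𝕜 := ℂ) ((C x).1 - (C' x).1) v)) := by
    change shift (coin C (lp.single 2 x v)) - shift (coin C' (lp.single 2 x v)) = _
    rw [← map_sub]
    congr 1
    ext1; funext j
    rw [lp.coeFn_sub, Pi.sub_apply, coin_apply, coin_apply]
    by_cases hj : j = x
    · subst hj
      rw [lp.single_apply_self, lp.single_apply_self, map_sub]
      rfl
    · rw [lp.single_apply_ne _ _ _ hj, lp.single_apply_ne _ _ _ hj, map_zero, map_zero, sub_zero]
  rw [h1, LinearIsometry.norm_map, lp.norm_single (by norm_num)]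
  exact ContinuousLinearMap.le_opNorm _ _

/-- The difference of two walks is the norm convergent sum, over the sites `x`, of its restrictions
to functions supported at `x`. These have finite rank. -/
theorem isCompactOperator_walk_sub_walk {C C' : ℤ → Matrix.unitaryGroup (Fin 2) ℂ}
    (h : Summable (coinDist C C')) : IsCompactOperator (walk C - walk C') := by
  let R : ℤ → EuclideanSpace ℂ (Fin 2) →L[ℂ] State := fun x =>
    (walk C - walk C') ∘L lp.singleContinuousLinearMap ℂ (fun _ : ℤ => EuclideanSpace ℂ (Fin 2)) 2 x
  let ev : (x : ℤ) → State →L[ℂ] EuclideanSpace ℂ (Fin 2) := fun x =>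
    lp.evalCLM ℂ (fun _ : ℤ => EuclideanSpace ℂ (Fin 2)) 2 x
  have hbound : ∀ x, ‖R x ∘L ev x‖ ≤ coinDist C C' x := fun x => by
    refine ContinuousLinearMap.opNorm_le_bound _ (norm_nonneg _) fun ψ => ?_
    refine (norm_walk_sub_walk_single_le C C' x (ψ x)).trans ?_
    exact mul_le_mul_of_nonneg_left (lp.norm_apply_le_norm (by norm_num) ψ x) (norm_nonneg _)
  have hsum : Summable fun x => R x ∘L ev x := Summable.of_norm_bounded h hbound
  have heq : ∑' x, R x ∘L ev x = walk C - walk C' := by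
    refine ContinuousLinearMap.ext fun ψ => ?_
    have h1 : HasSum (fun x => (R x ∘L ev x) ψ) ((∑' x, R x ∘L ev x) ψ) :=
      hsum.hasSum.mapL (ContinuousLinearMap.apply ℂ State ψ)
    have h2 : HasSum (fun x => (R x ∘L ev x) ψ) ((walk C - walk C') ψ) :=
      (lp.hasSum_single (by norm_num) ψ).mapL (walk C - walk C')
    exact h1.unique h2
  have hcomp : ∀ x, IsCompactOperator (R x ∘L ev x) := fun x => by
    have : IsCompactOperator (id : EuclideanSpace ℂ (Fin 2) → EuclideanSpace ℂ (Fin 2)) :=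
      ⟨_, ProperSpace.isCompact_closedBall 0 1, Metric.closedBall_mem_nhds 0 one_pos⟩
    exact (this.clm_comp (R x)).comp_clm (ev x)
  have ht : Tendsto (fun s : Finset ℤ => ∑ x ∈ s, R x ∘L ev x) atTop (𝓝 (walk C - walk C')) :=
    heq ▸ hsum.hasSum
  refine isCompactOperator_of_tendsto ht (Eventually.of_forall fun s => ?_)
  exact (compactOperator (RingHom.id ℂ) State State).sum_mem fun x _ => hcomp x

end Perturbation

/-! ### The walk with constant coin, and plane waves -/

section ConstantCoin

/-- The translation `(τ_h ψ)(x) = ψ(x + h)` of `ℓ²(ℤ; ℂ²)`. -/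
def translation (h : ℤ) : State →ₗᵢ[ℂ] State where
  toFun ψ := ⟨fun x => ψ (x + h), (memlp_two_iff _).2
    ((Equiv.addRight h).summable_iff.2 (hasSum_norm_sq ψ).summable)⟩
  map_add' _ _ := rfl
  map_smul' _ _ := rfl
  norm_map' ψ := norm_eq_of_hasSum _ _ (by
    have := (Equiv.addRight h).hasSum_iff.2 (hasSum_norm_sq ψ)
    exact this)

theorem translation_apply (h : ℤ) (ψ : State) (x : ℤ) : translation h ψ x = ψ (x + h) := rfl

/-- The Cayley–Hamilton identity for the symbol of a walk with constant coin. -/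
theorem walk_const_walk_const (A : Matrix.unitaryGroup (Fin 2) ℂ) (ψ : State) :
    walk (fun _ => A) (walk (fun _ => A) ψ) + A.1.det • ψ =
      A.1 0 0 • translation 1 (walk (fun _ => A) ψ) +
        A.1 1 1 • translation (-1) (walk (fun _ => A) ψ) := by
  ext x i
  simp only [lp.coeFn_add, lp.coeFn_smul, Pi.add_apply, Pi.smul_apply, translation_apply,
    Matrix.det_fin_two]
  fin_cases i
  · simp [walk_apply]
    ring_nf
  · simp [walk_apply]
    ring_nf

theorem boundedBelow_walk_const (A : Matrix.unitaryGroup (Fin 2) ℂ) {z : ℂ}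
    (hz : (‖A.1 0 0‖ + ‖A.1 1 1‖) * ‖z‖ < ‖z ^ 2 + A.1.det‖) :
    BoundedBelow (walk (fun _ => A) - z • ContinuousLinearMap.id ℂ State) := by
  set U := walk (fun _ => A) with hU
  set T : State → State := fun φ => A.1 0 0 • translation 1 φ + A.1 1 1 • translation (-1) φ with hT
  set τ : ℝ := ‖A.1 0 0‖ + ‖A.1 1 1‖ with hτ
  have hUn : ∀ φ, ‖U φ‖ = ‖φ‖ := (shift.comp (coin fun _ => A)).norm_map
  have hTn : ∀ φ, ‖T φ‖ ≤ τ * ‖φ‖ := fun φ => by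
    refine (norm_add_le _ _).trans (le_of_eq ?_)
    rw [norm_smul, norm_smul, LinearIsometry.norm_map, LinearIsometry.norm_map, hτ]
    ring
  have hτ0 : 0 ≤ τ := by positivity
  refine ⟨(‖z ^ 2 + A.1.det‖ - τ * ‖z‖) / (τ + 1 + ‖z‖), by
    have : 0 < ‖z ^ 2 + A.1.det‖ - τ * ‖z‖ := by linarith
    positivity, fun ψ => ?_⟩
  set r : State := (U - z • ContinuousLinearMap.id ℂ State) ψ with hr
  have hUψ : U ψ = r + z • ψ := by
    rw [hr]
    simp
  have e : (z ^ 2 + A.1.det) • ψ = z • T ψ + (T r - U r - z • r) := by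
    have h1 : U (U ψ) + A.1.det • ψ = T (U ψ) := walk_const_walk_const A ψ
    have h2 : T (U ψ) = T r + z • T ψ := by
      rw [hUψ]
      simp only [hT, map_add, map_smul]
      module
    rw [h2, hUψ, map_add, map_smul, hUψ] at h1
    rw [show z • T ψ + (T r - U r - z • r) = (T r + z • T ψ) - U r - z • r by abel, ← h1]
    module
  have h : ‖z ^ 2 + A.1.det‖ * ‖ψ‖ ≤ ‖z‖ * (τ * ‖ψ‖) + (τ * ‖r‖ + ‖r‖ + ‖z‖ * ‖r‖) := by
    rw [← norm_smul, e]
    refine (norm_add_le _ _).trans (add_le_add ?_ ?_)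
    · rw [norm_smul]
      exact mul_le_mul_of_nonneg_left (hTn ψ) (norm_nonneg _)
    · refine (norm_sub_le _ _).trans (add_le_add ((norm_sub_le _ _).trans ?_) ?_)
      · rw [hUn]
        exact add_le_add_left (hTn r) _
      · rw [norm_smul]
  rw [div_mul_eq_mul_div, div_le_iff₀ (by positivity)]
  linarith

theorem walk_const_single (A : Matrix.unitaryGroup (Fin 2) ℂ) (x : ℤ)
    (v : EuclideanSpace ℂ (Fin 2)) :
    walk (fun _ => A) (lp.single 2 x v) =
      lp.single 2 (x - 1) !₂[A.1 0 0 * v 0 + A.1 0 1 * v 1, 0] +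
        lp.single 2 (x + 1) !₂[0, A.1 1 0 * v 0 + A.1 1 1 * v 1] := by
  ext j i
  rw [lp.coeFn_add, Pi.add_apply, walk_apply]
  have e1 : j + 1 = x ↔ j = x - 1 := by omega
  have e2 : j - 1 = x ↔ j = x + 1 := by omega
  fin_cases i
  · simp only [PiLp.add_apply, single_apply_apply, e1]
    split_ifs <;> simp
  · simp only [PiLp.add_apply, single_apply_apply, e2]
    split_ifs <;> simp

/-- The plane wave with momentum `w` and amplitude `v`, cut off to `{0, …, n - 1}`. -/
def planeWave (w : ℂ) (v : EuclideanSpace ℂ (Fin 2)) (n : ℕ) : State :=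
  ∑ j ∈ Finset.range n, w ^ j • lp.single 2 (j : ℤ) v

theorem norm_single_two (x : ℤ) (v : EuclideanSpace ℂ (Fin 2)) :
    ‖(lp.single 2 x v : State)‖ = ‖v‖ := by
  rw [lp.norm_single (by norm_num)]

theorem norm_planeWave_sq {w : ℂ} (hw : ‖w‖ = 1) (v : EuclideanSpace ℂ (Fin 2)) (n : ℕ) :
    ‖planeWave w v n‖ ^ 2 = n * ‖v‖ ^ 2 := by
  have h := lp.norm_sum_single (p := 2) (by norm_num)
    (fun x : ℤ => (w ^ x • v : EuclideanSpace ℂ (Fin 2))) ((Finset.range n).map Nat.castEmbedding)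
  have h2 : (2 : ENNReal).toReal = ((2 : ℕ) : ℝ) := by norm_num
  rw [Finset.sum_map, Finset.sum_map, h2, Real.rpow_natCast] at h
  have e : ∀ j : ℕ, (lp.single 2 (Nat.castEmbedding j : ℤ)
      (w ^ (Nat.castEmbedding j : ℤ) • v) : State) = w ^ j • lp.single 2 (j : ℤ) v := fun j => by
    rw [Nat.castEmbedding_apply, zpow_natCast, lp.single_smul]
  rw [Finset.sum_congr rfl fun j _ => e j] at h
  rw [planeWave, h, Finset.sum_congr rfl (g := fun _ => ‖v‖ ^ 2) fun j _ => by
    rw [norm_smul, norm_zpow, hw, one_zpow, one_mul, Real.rpow_natCast]]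
  simp

/-- If `v` is an eigenvector of the symbol of a walk with constant coin, `U - z` maps the cut-off
plane waves to the two ends of the interval, with a norm independent of its length. -/
theorem norm_walk_const_planeWave_le {A : Matrix.unitaryGroup (Fin 2) ℂ} {z w : ℂ}
    (hw : ‖w‖ = 1) {v : EuclideanSpace ℂ (Fin 2)}
    (h0 : w * (A.1 0 0 * v 0 + A.1 0 1 * v 1) = z * v 0)
    (h1 : w⁻¹ * (A.1 1 0 * v 0 + A.1 1 1 * v 1) = z * v 1) :
    ∃ B : ℝ, ∀ n, ‖walk (fun _ => A) (planeWave w v n) - z • planeWave w v n‖ ≤ B := by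
  have hw0 : w ≠ 0 := norm_pos_iff.1 (by rw [hw]; norm_num)
  set P : EuclideanSpace ℂ (Fin 2) := !₂[A.1 0 0 * v 0 + A.1 0 1 * v 1, 0] with hP
  set Q : EuclideanSpace ℂ (Fin 2) := !₂[0, A.1 1 0 * v 0 + A.1 1 1 * v 1] with hQ
  have hPQ : z • v = w • P + w⁻¹ • Q := by
    ext i
    fin_cases i
    · simp [hP, hQ, h0]
    · simp [hP, hQ, h1]
  obtain ⟨g, hg⟩ : ∃ g : ℕ → State, ∀ j, g j = w ^ j • lp.single 2 ((j : ℤ) - 1) P :=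
    ⟨_, fun _ => rfl⟩
  obtain ⟨k, hk⟩ : ∃ k : ℕ → State, ∀ j, k j = (w ^ j * w⁻¹) • lp.single 2 (j : ℤ) Q :=
    ⟨_, fun _ => rfl⟩
  have hterm : ∀ j : ℕ, walk (fun _ => A) (w ^ j • lp.single 2 (j : ℤ) v) -
      z • (w ^ j • lp.single 2 (j : ℤ) v : State) = (k (j + 1) - k j) - (g (j + 1) - g j) :=
    fun j => by
      have e1 : (z • lp.single 2 (j : ℤ) v : State) =
          w • lp.single 2 (j : ℤ) P + w⁻¹ • lp.single 2 (j : ℤ) Q := by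
        rw [← lp.single_smul, hPQ, lp.single_add, lp.single_smul, lp.single_smul]
      have e3 : w ^ (j + 1) * w⁻¹ = w ^ j := by
        rw [pow_succ, mul_assoc, mul_inv_cancel₀ hw0, mul_one]
      have e4 : (((j + 1 : ℕ) : ℤ) - 1) = j := by push_cast; ring
      have e5 : ((j + 1 : ℕ) : ℤ) = (j : ℤ) + 1 := by push_cast; ring
      rw [map_smul, walk_const_single, smul_comm z, e1, hg, hg, hk, hk, e3, e4, e5]
      module
  have hsum : ∀ n, walk (fun _ => A) (planeWave w v n) - z • planeWave w v n =
      (k n - k 0) - (g n - g 0) := fun n => by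
    rw [planeWave, map_sum, Finset.smul_sum, ← Finset.sum_sub_distrib,
      Finset.sum_congr rfl fun j _ => hterm j, Finset.sum_sub_distrib, Finset.sum_range_sub,
      Finset.sum_range_sub]
  have hgn : ∀ n, ‖g n‖ = ‖P‖ := fun n => by
    rw [hg, norm_smul, norm_single_two, norm_pow, hw, one_pow, one_mul]
  have hkn : ∀ n, ‖k n‖ = ‖Q‖ := fun n => by
    rw [hk, norm_smul, norm_single_two, norm_mul, norm_pow, norm_inv, hw, one_pow, inv_one,
      one_mul, one_mul]
  refine ⟨2 * ‖P‖ + 2 * ‖Q‖, fun n => ?_⟩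
  rw [hsum]
  have b1 := norm_sub_le (k n - k 0) (g n - g 0)
  have b2 := norm_sub_le (k n) (k 0)
  have b3 := norm_sub_le (g n) (g 0)
  rw [hkn, hkn] at b2
  rw [hgn, hgn] at b3
  linarith

/-- The cut-off plane waves, whose norms tend to infinity, have bounded images under `U - z`: for
the constant coin by telescoping, and for a summable perturbation of it by the triangle
inequality. -/
theorem not_boundedBelow_of_planeWave {C : ℤ → Matrix.unitaryGroup (Fin 2) ℂ}
    {A : Matrix.unitaryGroup (Fin 2) ℂ} (hC : Summable (coinDist C fun _ => A)) {z w : ℂ}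
    (hw : ‖w‖ = 1) {v : EuclideanSpace ℂ (Fin 2)} (hv : v ≠ 0)
    (h0 : w * (A.1 0 0 * v 0 + A.1 0 1 * v 1) = z * v 0)
    (h1 : w⁻¹ * (A.1 1 0 * v 0 + A.1 1 1 * v 1) = z * v 1) :
    ¬ BoundedBelow (walk C - z • ContinuousLinearMap.id ℂ State) := by
  rintro ⟨c, hc, hb⟩
  obtain ⟨B, hB⟩ := norm_walk_const_planeWave_le hw h0 h1
  have hsN : Summable fun j : ℕ => coinDist C (fun _ => A) j * ‖v‖ :=
    (hC.comp_injective Nat.cast_injective).mul_right _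
  have hpert : ∀ n, ‖(walk C - walk fun _ => A) (planeWave w v n)‖ ≤
      ∑' j : ℕ, coinDist C (fun _ => A) j * ‖v‖ := fun n => by
    rw [planeWave, map_sum]
    refine (norm_sum_le _ _).trans (le_trans (Finset.sum_le_sum fun j _ => ?_)
      (hsN.sum_le_tsum (Finset.range n) fun j _ => mul_nonneg (norm_nonneg _) (norm_nonneg _)))
    rw [map_smul, norm_smul, norm_pow, hw, one_pow, one_mul]
    exact norm_walk_sub_walk_single_le _ _ _ _
  set M : ℝ := ∑' j : ℕ, coinDist C (fun _ => A) j * ‖v‖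
  have hbd : ∀ n, c * ‖planeWave w v n‖ ≤ M + B := fun n => by
    refine (hb (planeWave w v n)).trans ?_
    have e : (walk C - z • ContinuousLinearMap.id ℂ State) (planeWave w v n) =
        (walk C - walk fun _ => A) (planeWave w v n) +
          (walk (fun _ => A) (planeWave w v n) - z • planeWave w v n) := by
      simp only [sub_apply, smul_apply, ContinuousLinearMap.id_apply]
      abel
    rw [e]
    exact (norm_add_le _ _).trans (add_le_add (hpert n) (hB n))
  have hv0 : 0 < c ^ 2 * ‖v‖ ^ 2 := by
    have := norm_pos_iff.2 hv
    positivity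
  obtain ⟨n, hn⟩ := exists_nat_gt ((M + B) ^ 2 / (c ^ 2 * ‖v‖ ^ 2))
  rw [div_lt_iff₀ hv0] at hn
  have h2 : (c * ‖planeWave w v n‖) ^ 2 ≤ (M + B) ^ 2 :=
    pow_le_pow_left₀ (by positivity) (hbd n) 2
  rw [mul_pow, norm_planeWave_sq hw] at h2
  linarith

end ConstantCoin

/-! ### The free coin -/

section FreeCoin

theorem exp_I_mul_mul_exp_neg (t : ℂ) :
    Complex.exp (Complex.I * t) * Complex.exp (-(Complex.I * t)) = 1 := by
  rw [← Complex.exp_add, add_neg_cancel, Complex.exp_zero]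

theorem norm_exp_I_mul_ofReal (t : ℝ) : ‖Complex.exp (Complex.I * t)‖ = 1 := by
  rw [mul_comm, Complex.norm_exp_ofReal_mul_I]

theorem norm_exp_I_mul_half (t : ℝ) : ‖Complex.exp (Complex.I * (t / 2))‖ = 1 := by
  have := norm_exp_I_mul_ofReal (t / 2)
  push_cast at this
  exact this

theorem det_coinZero {p q : ℝ} (hpq : p ^ 2 + q ^ 2 = 1) (α β γ : ℝ) :
    (coinZero p q α β γ).det = Complex.exp (Complex.I * (γ / 2)) ^ 2 := by
  have h : (p : ℂ) ^ 2 + (q : ℂ) ^ 2 = 1 := by exact_mod_cast hpq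
  have h1 := exp_I_mul_mul_exp_neg (α - γ / 2)
  have h2 := exp_I_mul_mul_exp_neg (β - γ / 2)
  rw [Matrix.det_fin_two]
  simp only [coinZero, Matrix.smul_apply, Matrix.of_apply, Matrix.cons_val', Matrix.cons_val_zero,
    Matrix.cons_val_one, Matrix.cons_val_fin_one, smul_eq_mul]
  linear_combination Complex.exp (Complex.I * (γ / 2)) ^ 2 * (p ^ 2 * h1 + q ^ 2 * h2 + h)

theorem coinZero_mem {p q : ℝ} (hpq : p ^ 2 + q ^ 2 = 1) (α β γ : ℝ) :
    coinZero p q α β γ ∈ Matrix.unitaryGroup (Fin 2) ℂ := by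
  have h : (p : ℂ) ^ 2 + (q : ℂ) ^ 2 = 1 := by exact_mod_cast hpq
  have c2 : (starRingEnd ℂ) 2 = 2 := Complex.conj_ofNat 2
  have h0 := exp_I_mul_mul_exp_neg (γ / 2)
  have h1 := exp_I_mul_mul_exp_neg (α - γ / 2)
  have h2 := exp_I_mul_mul_exp_neg (β - γ / 2)
  rw [Matrix.mem_unitaryGroup_iff]
  ext i j
  fin_cases i <;> fin_cases j <;>
    simp [coinZero, Matrix.mul_apply, Fin.sum_univ_two, Matrix.star_apply, ← Complex.exp_conj, c2]
  · linear_combination (p ^ 2 * (Complex.exp (Complex.I * (α - γ / 2)) *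
      Complex.exp (-(Complex.I * (α - γ / 2)))) + q ^ 2 * (Complex.exp (Complex.I * (β - γ / 2)) *
      Complex.exp (-(Complex.I * (β - γ / 2))))) * h0 + p ^ 2 * h1 + q ^ 2 * h2 + h
  · ring
  · ring
  · linear_combination (p ^ 2 * (Complex.exp (Complex.I * (α - γ / 2)) *
      Complex.exp (-(Complex.I * (α - γ / 2)))) + q ^ 2 * (Complex.exp (Complex.I * (β - γ / 2)) *
      Complex.exp (-(Complex.I * (β - γ / 2))))) * h0 + p ^ 2 * h1 + q ^ 2 * h2 + h

theorem coinZero_zero_zero (p q α β γ : ℝ) : coinZero p q α β γ 0 0 =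
    Complex.exp (Complex.I * (γ / 2)) * (p * Complex.exp (Complex.I * ((α - γ / 2 : ℝ) : ℂ))) := by
  simp [coinZero]

theorem coinZero_one_one (p q α β γ : ℝ) : coinZero p q α β γ 1 1 =
    Complex.exp (Complex.I * (γ / 2)) *
      (p * Complex.exp (Complex.I * ((-(α - γ / 2) : ℝ) : ℂ))) := by
  simp only [coinZero, Complex.ofReal_neg, Complex.ofReal_sub, Complex.ofReal_div,
    Complex.ofReal_ofNat, mul_neg]
  simp

theorem norm_coinZero_diag {p : ℝ} (hp : 0 < p) (q α β γ : ℝ) :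
    ‖coinZero p q α β γ 0 0‖ = p ∧ ‖coinZero p q α β γ 1 1‖ = p := by
  have h := norm_exp_I_mul_half γ
  rw [coinZero_zero_zero, coinZero_one_one]
  simp only [norm_mul, h, norm_exp_I_mul_ofReal, Complex.norm_real, Real.norm_of_nonneg hp.le]
  simp

end FreeCoin

/-! ### The arcs on the unit circle -/

section Arcs

/-- For `z = e^{iθ}` this is `cos (θ - γ / 2)`. It lies in `[-p, p]` exactly if `z` is in the
essential spectrum, and equals `± p` exactly at the thresholds. -/
def tiltedRe (γ : ℝ) (z : ℂ) : ℝ := (z * Complex.exp (-(Complex.I * (γ / 2)))).re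

theorem tiltedRe_exp (γ θ : ℝ) :
    tiltedRe γ (Complex.exp (Complex.I * θ)) = Real.cos (θ - γ / 2) := by
  rw [tiltedRe, ← Complex.exp_add]
  have : Complex.I * θ + -(Complex.I * (γ / 2)) = ((θ - γ / 2 : ℝ) : ℂ) * Complex.I := by
    push_cast; ring
  rw [this, Complex.exp_ofReal_mul_I_re]

/-- The characteristic polynomial of the symbol of the free walk, at a point of the circle. -/
theorem sq_add_exp_sq {z : ℂ} (hz : ‖z‖ = 1) (γ : ℝ) :
    z ^ 2 + Complex.exp (Complex.I * (γ / 2)) ^ 2 =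
      z * (Complex.exp (Complex.I * (γ / 2)) * (2 * (tiltedRe γ z : ℂ))) := by
  have h := exp_I_mul_mul_exp_neg (γ / 2)
  have hz1 : z * (starRingEnd ℂ) z = 1 := by
    rw [Complex.mul_conj, Complex.normSq_eq_norm_sq, hz]; norm_num
  have c2 : (starRingEnd ℂ) 2 = 2 := Complex.conj_ofNat 2
  have h2 : 2 * (tiltedRe γ z : ℂ) = z * Complex.exp (-(Complex.I * (γ / 2))) +
      (starRingEnd ℂ) z * Complex.exp (Complex.I * (γ / 2)) := by
    have := Complex.add_conj (z * Complex.exp (-(Complex.I * (γ / 2))))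
    rw [map_mul, ← Complex.exp_conj] at this
    rw [tiltedRe]
    push_cast at this
    rw [← this]
    simp [c2]
  rw [h2]
  linear_combination -z ^ 2 * h - Complex.exp (Complex.I * (γ / 2)) ^ 2 * hz1

theorem norm_sq_add_exp_sq {z : ℂ} (hz : ‖z‖ = 1) (γ : ℝ) :
    ‖z ^ 2 + Complex.exp (Complex.I * (γ / 2)) ^ 2‖ = 2 * |tiltedRe γ z| := by
  have h := norm_exp_I_mul_half γ
  rw [sq_add_exp_sq hz, norm_mul, norm_mul, norm_mul, hz, h, Complex.norm_real]
  simp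

theorem abs_cos_le_of_mem_Icc {p φ : ℝ} (hp : 0 < p) (hp1 : p ≤ 1)
    (hφ : φ ∈ Set.Icc (Real.arccos p) (Real.pi - Real.arccos p)) : |Real.cos φ| ≤ p := by
  have h0 := Real.arccos_nonneg p
  have hc : Real.cos (Real.arccos p) = p := Real.cos_arccos (by linarith) hp1
  have h1 := Real.cos_le_cos_of_nonneg_of_le_pi h0 (by linarith [hφ.2]) hφ.1
  have h2 := Real.cos_le_cos_of_nonneg_of_le_pi (by linarith [hφ.1]) (by linarith) hφ.2
  rw [Real.cos_pi_sub, hc] at h2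
  rw [hc] at h1
  exact abs_le.2 ⟨h2, h1⟩

theorem abs_cos_lt_of_mem_Ioo {p φ : ℝ} (hp : 0 < p) (hp1 : p ≤ 1)
    (hφ : φ ∈ Set.Ioo (Real.arccos p) (Real.pi - Real.arccos p)) : |Real.cos φ| < p := by
  have h0 := Real.arccos_nonneg p
  have hc : Real.cos (Real.arccos p) = p := Real.cos_arccos (by linarith) hp1
  have h1 := Real.cos_lt_cos_of_nonneg_of_le_pi h0 (by linarith [hφ.2]) hφ.1
  have h2 := Real.cos_lt_cos_of_nonneg_of_le_pi (by linarith [hφ.1]) (by linarith) hφ.2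
  rw [Real.cos_pi_sub, hc] at h2
  rw [hc] at h1
  exact abs_lt.2 ⟨h2, h1⟩

theorem abs_cos_le_of_mem_arcAngles {p γ θ : ℝ} (hp : 0 < p) (hp1 : p ≤ 1)
    (hθ : θ ∈ arcAngles p γ) : |Real.cos (θ - γ / 2)| ≤ p := by
  rcases hθ with h | h
  · exact abs_cos_le_of_mem_Icc hp hp1 ⟨by linarith [h.1], by linarith [h.2]⟩
  · rw [← abs_neg, ← Real.cos_sub_pi]
    exact abs_cos_le_of_mem_Icc hp hp1 ⟨by linarith [h.1], by linarith [h.2]⟩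

theorem abs_cos_lt_of_mem_arcAngles_diff {p γ θ : ℝ} (hp : 0 < p) (hp1 : p ≤ 1)
    (hθ : θ ∈ arcAngles p γ \ thresholdAngles p γ) : |Real.cos (θ - γ / 2)| < p := by
  obtain ⟨hθ, hn⟩ := hθ
  simp only [thresholdAngles, Set.mem_insert_iff, Set.mem_singleton_iff, not_or] at hn
  obtain ⟨n1, n2, n3, n4⟩ := hn
  rcases hθ with h | h
  · have h1 := lt_of_le_of_ne h.1 (Ne.symm n1)
    have h2 := lt_of_le_of_ne h.2 n2
    exact abs_cos_lt_of_mem_Ioo hp hp1 ⟨by linarith, by linarith⟩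
  · have h1 := lt_of_le_of_ne h.1 (Ne.symm n3)
    have h2 := lt_of_le_of_ne h.2 n4
    rw [← abs_neg, ← Real.cos_sub_pi]
    exact abs_cos_lt_of_mem_Ioo hp hp1 ⟨by linarith, by linarith⟩

theorem abs_tiltedRe_of_mem_thresholdAngles {p γ : ℝ} (hp : 0 < p) (hp1 : p ≤ 1) {z : ℂ}
    (hz : z ∈ onCircle (thresholdAngles p γ)) : |tiltedRe γ z| = p := by
  obtain ⟨θ, hθ, rfl⟩ := hz
  have hc : Real.cos (Real.arccos p) = p := Real.cos_arccos (by linarith) hp1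
  simp only [thresholdAngles, Set.mem_insert_iff, Set.mem_singleton_iff] at hθ
  change |tiltedRe γ (Complex.exp (Complex.I * θ))| = p
  rw [tiltedRe_exp]
  rcases hθ with rfl | rfl | rfl | rfl <;> rw [add_sub_cancel_right]
  · rw [hc, abs_of_pos hp]
  · rw [Real.cos_pi_sub, hc, abs_neg, abs_of_pos hp]
  · rw [add_comm, Real.cos_add_pi, hc, abs_neg, abs_of_pos hp]
  · rw [Real.cos_two_pi_sub, hc, abs_of_pos hp]

theorem mem_onCircle_arcAngles_iff {p γ : ℝ} (hp : 0 < p) (hp1 : p ≤ 1) {z : ℂ} :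
    z ∈ onCircle (arcAngles p γ) ↔ ‖z‖ = 1 ∧ |tiltedRe γ z| ≤ p := by
  constructor
  · rintro ⟨θ, hθ, rfl⟩
    change ‖Complex.exp (Complex.I * θ)‖ = 1 ∧ |tiltedRe γ (Complex.exp (Complex.I * θ))| ≤ p
    rw [tiltedRe_exp]
    exact ⟨norm_exp_I_mul_ofReal θ, abs_cos_le_of_mem_arcAngles hp hp1 hθ⟩
  · rintro ⟨hz, hr⟩
    obtain ⟨θ, rfl⟩ : ∃ θ : ℝ, Complex.exp (Complex.I * θ) = z := by
      refine ⟨z.arg, ?_⟩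
      have := Complex.norm_mul_exp_arg_mul_I z
      rw [hz] at this
      rw [mul_comm]
      simpa using this
    rw [tiltedRe_exp] at hr
    set c := Real.cos (θ - γ / 2) with hc
    obtain ⟨hr1, hr2⟩ := abs_le.1 hr
    have hcc : Real.cos (Real.arccos c) = c := Real.cos_arccos (by linarith) (by linarith)
    have hA : Real.arccos p ≤ Real.arccos c := Real.antitone_arccos hr2
    have hB : Real.arccos c ≤ Real.pi - Real.arccos p := by
      rw [← Real.arccos_neg]
      exact Real.antitone_arccos hr1
    -- the angle is determined up to sign, modulo `2π`, by its cosine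
    have hcos : Real.cos (θ - γ / 2) = Real.cos (Real.arccos c) := by rw [hcc]
    rw [Real.cos_eq_cos_iff] at hcos
    obtain ⟨k, hk⟩ := hcos
    have hper : ∀ (a b : ℝ) (m : ℤ), a = b + m * (2 * Real.pi) →
        Complex.exp (Complex.I * a) = Complex.exp (Complex.I * b) := fun a b m h => by
      rw [Complex.exp_eq_exp_iff_exists_int]
      refine ⟨m, ?_⟩
      rw [h]; push_cast; ring
    rcases hk with hk | hk
    · refine ⟨Real.arccos c + γ / 2, Or.inl ⟨by linarith, by linarith⟩, ?_⟩
      refine hper _ _ k ?_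
      linarith
    · refine ⟨2 * Real.pi - Real.arccos c + γ / 2, Or.inr ⟨by linarith, by linarith⟩, ?_⟩
      refine hper _ _ (1 - k) ?_
      push_cast
      linarith

theorem accPt_onCircle_arcAngles {p γ : ℝ} (hp : 0 < p) (hp1 : p ≤ 1) {z : ℂ}
    (hz : z ∈ onCircle (arcAngles p γ)) : AccPt z (𝓟 (onCircle (arcAngles p γ))) := by
  have hc : Real.cos (Real.arccos p) = p := Real.cos_arccos (by linarith) hp1
  have hh : Real.arccos p < Real.pi / 2 := Real.arccos_lt_pi_div_two.2 hp
  -- each arc is a connected set with more than one point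
  have key : ∀ a b : ℝ, a ≤ b → Real.cos (a - γ / 2) ≠ Real.cos (b - γ / 2) →
      z ∈ onCircle (Set.Icc a b) → AccPt z (𝓟 (onCircle (Set.Icc a b))) := by
    intro a b hab hne hz
    have hconn : IsPreconnected (onCircle (Set.Icc a b)) :=
      isPreconnected_Icc.image _ (by fun_prop)
    refine hconn.preperfect_of_nontrivial ?_ z hz
    refine ⟨_, ⟨a, ⟨le_rfl, hab⟩, rfl⟩, _, ⟨b, ⟨hab, le_rfl⟩, rfl⟩, fun h => hne ?_⟩
    have := congrArg (tiltedRe γ) h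
    change tiltedRe γ (Complex.exp (Complex.I * a)) =
      tiltedRe γ (Complex.exp (Complex.I * b)) at this
    rwa [tiltedRe_exp, tiltedRe_exp] at this
  obtain ⟨θ, hθ | hθ, hθz⟩ := hz
  · refine (key _ _ (by linarith) ?_ ⟨θ, hθ, hθz⟩).mono
      (principal_mono.2 (Set.image_mono Set.subset_union_left))
    rw [add_sub_cancel_right, add_sub_cancel_right, Real.cos_pi_sub, hc]
    linarith
  · refine (key _ _ (by linarith) ?_ ⟨θ, hθ, hθz⟩).mono
      (principal_mono.2 (Set.image_mono Set.subset_union_right))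
    rw [add_sub_cancel_right, add_sub_cancel_right, Real.cos_two_pi_sub, add_comm Real.pi,
      Real.cos_add_pi, hc]
    linarith

/-- Both the momenta of plane waves and the eigenvalues of the transfer matrices solve a quadratic
equation of this form. Its roots `e^{i(t ± κ)}`, `cos κ = r / p`, lie on the circle. -/
theorem exists_unimodular_roots {p r : ℝ} (hp : 0 < p) (hr : |r| ≤ p) (G : ℂ) (t : ℝ) :
    ∃ μ ν : ℂ, ‖μ‖ = 1 ∧ ‖ν‖ = 1 ∧ (|r| < p → μ ≠ ν) ∧
      G * (p * Complex.exp (Complex.I * (-t : ℝ))) * (μ * ν) =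
        G * (p * Complex.exp (Complex.I * t)) ∧
      G * (p * Complex.exp (Complex.I * (-t : ℝ))) * (μ + ν) = G * (2 * r) := by
  obtain ⟨h1, h2⟩ := abs_le.1 hr
  set κ := Real.arccos (r / p) with hκ
  have hcos : p * Real.cos κ = r := by
    rw [hκ, Real.cos_arccos (by rw [le_div_iff₀ hp]; linarith) (by rw [div_le_iff₀ hp]; linarith)]
    field_simp
  have hcosC : (p : ℂ) * Complex.cos κ = r := by exact_mod_cast hcos
  have e1 : ∀ a b : ℝ, Complex.exp (Complex.I * ((a + b : ℝ) : ℂ)) =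
      Complex.exp (Complex.I * a) * Complex.exp (Complex.I * b) := fun a b => by
    rw [← Complex.exp_add]; push_cast; ring_nf
  have e2 : Complex.exp (Complex.I * ((-t : ℝ) : ℂ)) * Complex.exp (Complex.I * t) = 1 := by
    rw [← e1]; simp
  have e3 : Complex.exp (Complex.I * ((-κ : ℝ) : ℂ)) * Complex.exp (Complex.I * κ) = 1 := by
    rw [← e1]; simp
  have e4 : Complex.exp (Complex.I * κ) + Complex.exp (Complex.I * ((-κ : ℝ) : ℂ)) =
      2 * Complex.cos κ := by
    rw [Complex.two_cos]
    push_cast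
    ring_nf
  refine ⟨Complex.exp (Complex.I * ((t + κ : ℝ) : ℂ)), Complex.exp (Complex.I * ((t + -κ : ℝ) : ℂ)),
    norm_exp_I_mul_ofReal _, norm_exp_I_mul_ofReal _, fun hlt h => ?_, ?_, ?_⟩
  · obtain ⟨h3, h4⟩ := abs_lt.1 hlt
    have hsin : 0 < Real.sin κ := by
      rw [hκ, Real.sin_arccos]
      refine Real.sqrt_pos.2 ?_
      have : (r / p) ^ 2 < 1 := by
        rw [sq_lt_one_iff_abs_lt_one, abs_div, abs_of_pos hp, div_lt_one hp]
        exact hlt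
      linarith
    rw [e1, e1] at h
    have h5 := mul_left_cancel₀ (Complex.exp_ne_zero _) h
    have h6 := congrArg Complex.im h5
    rw [mul_comm, mul_comm Complex.I, Complex.exp_ofReal_mul_I_im, Complex.exp_ofReal_mul_I_im,
      Real.sin_neg] at h6
    linarith
  · rw [e1, e1]
    linear_combination G * p * Complex.exp (Complex.I * t) *
      (Complex.exp (Complex.I * ((-κ : ℝ) : ℂ)) * Complex.exp (Complex.I * κ) * e2 + e3)
  · rw [e1, e1]
    linear_combination G * p * (Complex.exp (Complex.I * κ) +
      Complex.exp (Complex.I * ((-κ : ℝ) : ℂ))) * e2 + G * p * e4 + 2 * G * hcosC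

end Arcs

/-! ### Decay estimates -/

section Decay

theorem norm_entry_le_entryMax (A : Matrix (Fin 2) (Fin 2) ℂ) (i j : Fin 2) :
    ‖A i j‖ ≤ entryMax A := by
  unfold entryMax
  fin_cases i <;> fin_cases j <;> simp

theorem norm_toEuclideanCLM_le (A : Matrix (Fin 2) (Fin 2) ℂ) :
    ‖Matrix.toEuclideanCLM (n := Fin 2) (𝕜 := ℂ) A‖ ≤ 4 * entryMax A := by
  have h0 : 0 ≤ entryMax A := (norm_nonneg _).trans (norm_entry_le_entryMax A 0 0)
  refine ContinuousLinearMap.opNorm_le_bound _ (by positivity) fun v => ?_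
  have hrow : ∀ i, ‖(Matrix.toEuclideanCLM (n := Fin 2) (𝕜 := ℂ) A v) i‖ ≤
      2 * entryMax A * ‖v‖ := fun i => by
    have e : (Matrix.toEuclideanCLM (n := Fin 2) (𝕜 := ℂ) A v) i = A i 0 * v 0 + A i 1 * v 1 := by
      simp [Matrix.mulVec, dotProduct, Fin.sum_univ_two, Matrix.ofLp_toEuclideanCLM]
    rw [e]
    refine (norm_add_le _ _).trans ?_
    rw [norm_mul, norm_mul]
    have h1 := mul_le_mul (norm_entry_le_entryMax A i 0) (PiLp.norm_apply_le v 0)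
      (norm_nonneg _) h0
    have h2 := mul_le_mul (norm_entry_le_entryMax A i 1) (PiLp.norm_apply_le v 1)
      (norm_nonneg _) h0
    linarith
  refine abs_le_of_sq_le_sq' ?_ (by positivity) |>.2
  rw [EuclideanSpace.norm_sq_eq, Fin.sum_univ_two]
  have h1 := pow_le_pow_left₀ (norm_nonneg _) (hrow 0) 2
  have h2 := pow_le_pow_left₀ (norm_nonneg _) (hrow 1) 2
  nlinarith [sq_nonneg (entryMax A * ‖v‖)]

theorem summable_exp_neg_sqrt {ρ : ℝ} (hρ : 0 < ρ) :
    Summable fun x : ℤ => Real.exp (-ρ * Real.sqrt (1 + (x : ℝ) ^ 2)) := by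
  have hgeom : Summable fun n : ℕ => Real.exp (-ρ) ^ n :=
    summable_geometric_of_lt_one (Real.exp_nonneg _) (Real.exp_lt_one_iff.2 (by linarith))
  have hbound : ∀ n : ℕ, ∀ x : ℝ, x ^ 2 = (n : ℝ) ^ 2 →
      Real.exp (-ρ * Real.sqrt (1 + x ^ 2)) ≤ Real.exp (-ρ) ^ n := fun n x hx => by
    rw [← Real.exp_nat_mul, hx]
    refine Real.exp_le_exp.2 ?_
    have : (n : ℝ) ≤ Real.sqrt (1 + (n : ℝ) ^ 2) := Real.le_sqrt_of_sq_le (by linarith)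
    nlinarith
  refine Summable.of_nat_of_neg ?_ ?_
  · exact hgeom.of_nonneg_of_le (fun n => Real.exp_nonneg _) fun n => hbound n _ (by simp)
  · exact hgeom.of_nonneg_of_le (fun n => Real.exp_nonneg _) fun n => hbound n _ (by simp)

theorem norm_one_one_eq (A : Matrix.unitaryGroup (Fin 2) ℂ) : ‖A.1 1 1‖ = ‖A.1 0 0‖ := by
  have hconj : ∀ w : ℂ, w * (starRingEnd ℂ) w = ((‖w‖ ^ 2 : ℝ) : ℂ) := fun w => by
    rw [Complex.mul_conj, Complex.normSq_eq_norm_sq]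
  have h1 := congrFun (congrFun (Matrix.mem_unitaryGroup_iff.1 A.2) 0) 0
  have h2 := congrFun (congrFun (Matrix.mem_unitaryGroup_iff'.1 A.2) 1) 1
  simp only [Matrix.mul_apply, Fin.sum_univ_two, Matrix.star_apply, Matrix.one_apply_eq,
    RCLike.star_def] at h1 h2
  rw [hconj, hconj] at h1
  rw [mul_comm, hconj, mul_comm, hconj] at h2
  have h1' : ‖A.1 0 0‖ ^ 2 + ‖A.1 0 1‖ ^ 2 = 1 := by exact_mod_cast h1
  have h2' : ‖A.1 0 1‖ ^ 2 + ‖A.1 1 1‖ ^ 2 = 1 := by exact_mod_cast h2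
  refine (pow_left_inj₀ (norm_nonneg _) (norm_nonneg _) two_ne_zero).1 ?_
  linarith

theorem tendsto_state_apply (ψ : State) (i : Fin 2) {f : ℕ → ℤ} (hf : Function.Injective f) :
    Tendsto (fun n => ψ (f n) i) atTop (𝓝 0) := by
  have h1 : Tendsto (fun n => ‖ψ (f n)‖ ^ 2) atTop (𝓝 0) := by
    rw [← Nat.cofinite_eq_atTop]
    exact (hasSum_norm_sq ψ).summable.tendsto_cofinite_zero.comp hf.tendsto_cofinite
  have h2 : Tendsto (fun n => ‖ψ (f n)‖) atTop (𝓝 0) := by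
    have := (Real.continuous_sqrt.tendsto 0).comp h1
    simpa [Function.comp_def, Real.sqrt_sq] using this
  exact squeeze_zero_norm (fun n => PiLp.norm_apply_le _ i) h2

end Decay

/-! ### The essential spectrum -/

section Spectrum

variable {p q α β γ : ℝ} {C : ℤ → Matrix.unitaryGroup (Fin 2) ℂ}
  {A : Matrix.unitaryGroup (Fin 2) ℂ}

theorem eventually_boundedBelow (hp : 0 < p) (hpq : p ^ 2 + q ^ 2 = 1)
    (hA : A.1 = coinZero p q α β γ) {z : ℂ} (hz : ‖z‖ = 1) (hr : p < |tiltedRe γ z|) :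
    ∀ᶠ w in 𝓝 z, BoundedBelow (walk (fun _ => A) - w • ContinuousLinearMap.id ℂ State) := by
  have hopen : IsOpen {w : ℂ | (‖A.1 0 0‖ + ‖A.1 1 1‖) * ‖w‖ < ‖w ^ 2 + A.1.det‖} :=
    isOpen_lt (by fun_prop) (by fun_prop)
  have hmem : z ∈ {w : ℂ | (‖A.1 0 0‖ + ‖A.1 1 1‖) * ‖w‖ < ‖w ^ 2 + A.1.det‖} := by
    obtain ⟨h0, h1⟩ := norm_coinZero_diag hp q α β γ
    rw [Set.mem_ofPred_eq, hA, h0, h1, det_coinZero hpq, norm_sq_add_exp_sq hz, hz]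
    linarith
  filter_upwards [hopen.mem_nhds hmem] with w hw
  exact boundedBelow_walk_const A hw

theorem mem_spectrum_of_abs_tiltedRe_le (hp : 0 < p) (hpq : p ^ 2 + q ^ 2 = 1)
    (hA : A.1 = coinZero p q α β γ) (hC : Summable (coinDist C fun _ => A)) {z : ℂ}
    (hz : ‖z‖ = 1) (hr : |tiltedRe γ z| ≤ p) : z ∈ spectrum ℂ (walk C) := by
  by_contra hspec
  -- `w` is chosen so that `z` is an eigenvalue of the symbol at momentum `w`
  obtain ⟨w, w', hw, hw', -, hprod, hsum⟩ :=
    exists_unimodular_roots hp hr (Complex.exp (Complex.I * (γ / 2))) (-(α - γ / 2))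
  have hw0 : w ≠ 0 := norm_pos_iff.1 (by rw [hw]; norm_num)
  rw [neg_neg, ← coinZero_zero_zero p q α β γ, ← coinZero_one_one p q α β γ, ← hA] at hprod
  rw [neg_neg, ← coinZero_zero_zero p q α β γ, ← hA] at hsum
  have hdet := det_coinZero hpq α β γ
  rw [← hA, Matrix.det_fin_two] at hdet
  have hchar := sq_add_exp_sq hz γ
  rw [← hdet, ← hsum] at hchar
  have hsing : (!![w * A.1 0 0 - z, w * A.1 0 1; w⁻¹ * A.1 1 0, w⁻¹ * A.1 1 1 - z] :
      Matrix (Fin 2) (Fin 2) ℂ).det = 0 := by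
    rw [Matrix.det_fin_two_of]
    have h1 : w * w⁻¹ = 1 := mul_inv_cancel₀ hw0
    linear_combination hchar + (A.1 0 0 * A.1 1 1 - A.1 0 1 * A.1 1 0 - z * A.1 0 0 * w') * h1 +
      z * w⁻¹ * hprod
  obtain ⟨v, hv, hv0⟩ := Matrix.exists_mulVec_eq_zero_iff.2 hsing
  have e0 := congrFun hv0 0
  have e1 := congrFun hv0 1
  simp [Matrix.mulVec, dotProduct, Fin.sum_univ_two] at e0 e1
  refine not_boundedBelow_of_planeWave hC hw (v := WithLp.toLp 2 v) ?_ ?_ ?_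
    (BoundedBelow.of_notMem_spectrum hspec)
  · intro h
    exact hv (by simpa using h)
  · simp only
    linear_combination e0
  · simp only
    linear_combination e1

theorem essSpectrum_walk (hp : 0 < p) (hp1 : p ≤ 1) (hpq : p ^ 2 + q ^ 2 = 1)
    (hA : A.1 = coinZero p q α β γ) (hC : Summable (coinDist C fun _ => A)) :
    essSpectrum (walk C) = onCircle (arcAngles p γ) := by
  have hU := walk_mem_unitary C
  have hK := isCompactOperator_walk_sub_walk hC
  have hsub : onCircle (arcAngles p γ) ⊆ spectrum ℂ (walk C) := fun z hz => by
    obtain ⟨h1, h2⟩ := (mem_onCircle_arcAngles_iff hp hp1).1 hz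
    exact mem_spectrum_of_abs_tiltedRe_le hp hpq hA hC h1 h2
  ext z
  constructor
  · rintro ⟨hz, hd⟩
    have hz1 : ‖z‖ = 1 := by
      simpa using spectrum.subset_circle_of_unitary hU hz
    rw [mem_onCircle_arcAngles_iff hp hp1]
    refine ⟨hz1, not_lt.1 fun hr => hd ?_⟩
    have hev := eventually_boundedBelow hp hpq hA hz1 hr
    refine ⟨?_, not_accPt_spectrum hU hK hev hz1,
      finiteDimensional_eigenspace hK hev.self_of_nhds⟩
    obtain ⟨φ, hφ1, hφ⟩ := exists_eigenvector hU hK hev.self_of_nhds hz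
    refine Module.End.hasEigenvalue_of_hasEigenvector (x := φ)
      ⟨Module.End.mem_eigenspace_iff.2 hφ, ?_⟩
    rintro rfl
    simp at hφ1
  · intro hz
    exact ⟨hsub hz, fun hd => hd.2.1
      ((accPt_onCircle_arcAngles hp hp1 hz).mono (principal_mono.2 hsub))⟩

end Spectrum

/-! ### Vanishing of eigenfunctions on half-lines -/

section Embedded

variable {p q α β γ : ℝ} {C : ℤ → Matrix.unitaryGroup (Fin 2) ℂ}
  {A : Matrix.unitaryGroup (Fin 2) ℂ}

theorem eigenfunction_apply_zero {z : ℂ} {ψ : State} (hψ : walk C ψ = z • ψ) (x : ℤ) :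
    z * ψ x 0 = (C (x + 1)).1 0 0 * ψ (x + 1) 0 + (C (x + 1)).1 0 1 * ψ (x + 1) 1 := by
  have h : walk C ψ x 0 = (z • ψ) x 0 := by rw [hψ]
  rw [walk_apply] at h
  exact h.symm

theorem eigenfunction_apply_one {z : ℂ} {ψ : State} (hψ : walk C ψ = z • ψ) (x : ℤ) :
    z * ψ x 1 = (C (x - 1)).1 1 0 * ψ (x - 1) 0 + (C (x - 1)).1 1 1 * ψ (x - 1) 1 := by
  have h : walk C ψ x 1 = (z • ψ) x 1 := by rw [hψ]
  rw [walk_apply] at h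
  exact h.symm

/-- To the right of `k`, the pairs `(ψ⁽⁰⁾(x - 1), ψ⁽¹⁾(x))` of a solution of `U ψ = z ψ` satisfy a
transfer matrix recursion with coins summably close to `A`. -/
theorem eigenfunction_eq_zero_right (hp : 0 < p) (hpq : p ^ 2 + q ^ 2 = 1)
    (hA : A.1 = coinZero p q α β γ) {ε : ℤ → ℝ} (hε : Summable ε) {δ : ℝ} (hδ : 0 < δ) {k : ℤ}
    (hC : ∀ x, k < x → ∀ i j, ‖(C x).1 i j - A.1 i j‖ ≤ ε x)
    (hCδ : ∀ x, k < x → δ ≤ ‖(C x).1 0 0‖) {z : ℂ} (hz : ‖z‖ = 1) (hr : |tiltedRe γ z| < p)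
    {ψ : State} (hψ : walk C ψ = z • ψ) {x : ℤ} (hx : k < x) : ψ x = 0 := by
  obtain ⟨μ, ν, hμ, hν, hne, hprod, hsum⟩ :=
    exists_unimodular_roots hp hr.le (Complex.exp (Complex.I * (γ / 2))) (α - γ / 2)
  rw [← coinZero_zero_zero p q α β γ, ← coinZero_one_one p q α β γ, ← hA] at hprod
  rw [← coinZero_one_one p q α β γ, ← hA] at hsum
  have hdet := det_coinZero hpq α β γ
  rw [← hA, Matrix.det_fin_two] at hdet
  have hchar := sq_add_exp_sq hz γ
  rw [← hdet, ← hsum] at hchar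
  have hd : A.1 1 1 ≠ 0 := norm_pos_iff.1 (by
    rw [hA, (norm_coinZero_diag hp q α β γ).2]; exact hp)
  have hinj : ∀ c : ℤ, Function.Injective fun n : ℕ => c + (n : ℤ) := fun c m n h => by
    simpa using h
  have hlt : ∀ n : ℕ, k < k + 1 + n := fun n => by omega
  have key := eq_zero_of_halfLine_solution hz hd hμ hν (hne hr) (by linear_combination hchar) hprod
    (A := fun n => (C (k + 1 + n)).1 0 0) (B := fun n => (C (k + 1 + n)).1 0 1)
    (C := fun n => (C (k + 1 + n)).1 1 0) (D := fun n => (C (k + 1 + n)).1 1 1) hδ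
    (fun n => by rw [norm_one_one_eq]; exact hCδ _ (hlt n))
    (fun n => entry_norm_bound_of_unitary (C (k + 1 + n)).2 1 0)
    (hε.comp_injective (hinj (k + 1)))
    (fun n => hC _ (hlt n) 0 0) (fun n => hC _ (hlt n) 0 1) (fun n => hC _ (hlt n) 1 0)
    (fun n => hC _ (hlt n) 1 1) (s := fun n => ψ (k + n) 0) (t := fun n => ψ (k + 1 + n) 1)
    (fun n => by
      have h := eigenfunction_apply_zero hψ (k + n)
      rw [show k + (n : ℤ) + 1 = k + 1 + n by ring] at h
      rw [show k + ((n + 1 : ℕ) : ℤ) = k + 1 + n by push_cast; ring]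
      exact h)
    (fun n => by
      have h := eigenfunction_apply_one hψ (k + 1 + (n + 1 : ℕ))
      rw [show k + 1 + ((n + 1 : ℕ) : ℤ) - 1 = k + 1 + n by push_cast; ring] at h
      rw [show k + ((n + 1 : ℕ) : ℤ) = k + 1 + n by push_cast; ring]
      exact h)
    (tendsto_state_apply ψ 0 (hinj k)) (tendsto_state_apply ψ 1 (hinj (k + 1)))
  ext i
  fin_cases i
  · have h := (key (x - k).toNat).1
    rw [show k + ((x - k).toNat : ℤ) = x by omega] at h
    exact h
  · have h := (key (x - k - 1).toNat).2
    rw [show k + 1 + ((x - k - 1).toNat : ℤ) = x by omega] at h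
    exact h

/-- The mirror image of `eigenfunction_eq_zero_right`: the reflection `x ↦ -x` exchanges the two
components, and thus the two rows and the two columns of the coins. -/
theorem eigenfunction_eq_zero_left (hp : 0 < p) (hpq : p ^ 2 + q ^ 2 = 1)
    (hA : A.1 = coinZero p q α β γ) {ε : ℤ → ℝ} (hε : Summable ε) {δ : ℝ} (hδ : 0 < δ) {k : ℤ}
    (hC : ∀ x, x < k → ∀ i j, ‖(C x).1 i j - A.1 i j‖ ≤ ε x)
    (hCδ : ∀ x, x < k → δ ≤ ‖(C x).1 0 0‖) {z : ℂ} (hz : ‖z‖ = 1) (hr : |tiltedRe γ z| < p)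
    {ψ : State} (hψ : walk C ψ = z • ψ) {x : ℤ} (hx : x < k) : ψ x = 0 := by
  obtain ⟨μ, ν, hμ, hν, hne, hprod, hsum⟩ :=
    exists_unimodular_roots hp hr.le (Complex.exp (Complex.I * (γ / 2))) (-(α - γ / 2))
  rw [neg_neg, ← coinZero_zero_zero p q α β γ, ← coinZero_one_one p q α β γ, ← hA] at hprod
  rw [neg_neg, ← coinZero_zero_zero p q α β γ, ← hA] at hsum
  have hdet := det_coinZero hpq α β γ
  rw [← hA, Matrix.det_fin_two] at hdet
  have hchar := sq_add_exp_sq hz γ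
  rw [← hdet, ← hsum] at hchar
  have hd : A.1 0 0 ≠ 0 := norm_pos_iff.1 (by
    rw [hA, (norm_coinZero_diag hp q α β γ).1]; exact hp)
  have hinj : ∀ c : ℤ, Function.Injective fun n : ℕ => c - (n : ℤ) := fun c m n h => by
    simpa using h
  have hlt : ∀ n : ℕ, k - 1 - n < k := fun n => by omega
  have key := eq_zero_of_halfLine_solution (a := A.1 1 1) (b := A.1 1 0) (c := A.1 0 1) hz hd hμ hν
    (hne hr) (by linear_combination hchar) hprod
    (A := fun n => (C (k - 1 - n)).1 1 1) (B := fun n => (C (k - 1 - n)).1 1 0)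
    (C := fun n => (C (k - 1 - n)).1 0 1) (D := fun n => (C (k - 1 - n)).1 0 0) hδ
    (fun n => hCδ _ (hlt n))
    (fun n => entry_norm_bound_of_unitary (C (k - 1 - n)).2 0 1)
    (hε.comp_injective (hinj (k - 1)))
    (fun n => hC _ (hlt n) 1 1) (fun n => hC _ (hlt n) 1 0) (fun n => hC _ (hlt n) 0 1)
    (fun n => hC _ (hlt n) 0 0) (s := fun n => ψ (k - n) 1) (t := fun n => ψ (k - 1 - n) 0)
    (fun n => by
      have h := eigenfunction_apply_one hψ (k - n)
      rw [show k - (n : ℤ) - 1 = k - 1 - n by ring] at h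
      rw [show k - ((n + 1 : ℕ) : ℤ) = k - 1 - n by push_cast; ring]
      linear_combination h)
    (fun n => by
      have h := eigenfunction_apply_zero hψ (k - 1 - (n + 1 : ℕ))
      rw [show k - 1 - ((n + 1 : ℕ) : ℤ) + 1 = k - 1 - n by push_cast; ring] at h
      rw [show k - ((n + 1 : ℕ) : ℤ) = k - 1 - n by push_cast; ring]
      linear_combination h)
    (tendsto_state_apply ψ 1 (hinj k)) (tendsto_state_apply ψ 0 (hinj (k - 1)))
  ext i
  fin_cases i
  · have h := (key (k - 1 - x).toNat).2
    rw [show k - 1 - ((k - 1 - x).toNat : ℤ) = x by omega] at h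
    exact h
  · have h := (key (k - x).toNat).1
    rw [show k - ((k - x).toNat : ℤ) = x by omega] at h
    exact h

end Embedded

/-! ### The defect set -/

section Defect

theorem mem_defectSet {N : ℕ} (y : Fin N → ℤ) (j : Fin N) :
    y j - 1 ∈ defectSet y ∧ y j ∈ defectSet y := by
  simp only [defectSet, Finset.mem_biUnion, Finset.mem_univ, true_and, Finset.mem_insert,
    Finset.mem_singleton]
  exact ⟨⟨j, Or.inl rfl⟩, ⟨j, Or.inr rfl⟩⟩

theorem edgeState_apply_of_notMem_defectSet {N : ℕ} {y : Fin N → ℤ} {x : ℤ} (hx : x ∉ defectSet y)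
    (β' γ' : ℝ) (ε : ℂ) (j : Fin N) : edgeState β' γ' ε (y j) x = 0 :=
  edgeState_apply_of_notMem (fun h => hx (h ▸ (mem_defectSet y j).1))
    (fun h => hx (h ▸ (mem_defectSet y j).2))

theorem walk_defectCoin_edgeState {N : ℕ} (y : Fin N → ℤ) (β' γ' : ℝ)
    (C₂ : ℤ → Matrix.unitaryGroup (Fin 2) ℂ) {ε : ℂ} (hε : ε = 1 ∨ ε = -1) (j : Fin N) :
    walk (defectCoin (defectSet y) (coinOne β' γ') C₂) (edgeState β' γ' ε (y j)) =
      (ε * Complex.I * Complex.exp (Complex.I * (γ' / 2))) • edgeState β' γ' ε (y j) :=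
  walk_edgeState (if_pos (mem_defectSet y j).1) (if_pos (mem_defectSet y j).2) hε

theorem abs_tiltedRe_edge_eigenvalue (γ γ' : ℝ) {ε : ℂ} (hε : ε = 1 ∨ ε = -1) :
    |tiltedRe γ (ε * Complex.I * Complex.exp (Complex.I * (γ' / 2)))| =
      |Real.cos ((γ' + Real.pi) / 2 - γ / 2)| := by
  have h : Complex.I * Complex.exp (Complex.I * (γ' / 2)) =
      Complex.exp (Complex.I * (((γ' + Real.pi) / 2 : ℝ) : ℂ)) := by
    have e : Complex.I * (((γ' + Real.pi) / 2 : ℝ) : ℂ) =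
        Real.pi / 2 * Complex.I + Complex.I * (γ' / 2) := by push_cast; ring
    rw [e, Complex.exp_add, Complex.exp_pi_div_two_mul_I]
  rw [mul_assoc, h, ← tiltedRe_exp]
  rcases hε with rfl | rfl
  · rw [one_mul]
  · rw [neg_one_mul, tiltedRe, neg_mul, Complex.neg_re, abs_neg, ← tiltedRe]

theorem norm_edge_eigenvalue (γ' : ℝ) {ε : ℂ} (hε : ε = 1 ∨ ε = -1) :
    ‖ε * Complex.I * Complex.exp (Complex.I * (γ' / 2))‖ = 1 := by
  have h := norm_exp_I_mul_half γ'
  rcases hε with rfl | rfl <;> simp [h]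

end Defect

end QWalk

end

theorem theorem1p3
    (p q α β γ : ℝ) (hp : p ∈ Set.Ioc (0 : ℝ) 1) (hq : q ∈ Set.Icc (0 : ℝ) 1)
    (hpq : p ^ 2 + q ^ 2 = 1)
    (hα : α ∈ Set.Ico 0 (2 * Real.pi)) (hβ : β ∈ Set.Ico 0 (2 * Real.pi))
    (hγ : γ ∈ Set.Ico 0 (2 * Real.pi))
    (β' γ' : ℝ) (hβ' : β' ∈ Set.Ico 0 (2 * Real.pi)) (hγ' : γ' ∈ Set.Ico 0 (2 * Real.pi))
    (C₂ : ℤ → Matrix.unitaryGroup (Fin 2) ℂ)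
    (hexp : ∃ ρ > (0 : ℝ), ∃ M > (0 : ℝ), ∀ x : ℤ,
      QWalk.entryMax ((C₂ x).1 - QWalk.coinZero p q α β γ)
        ≤ M * Real.exp (-ρ * Real.sqrt (1 + (x : ℝ) ^ 2)))
    (hnondeg : ∃ δ > (0 : ℝ), ∀ x : ℤ, δ ≤ ‖(C₂ x).1 0 0‖)
    (N : ℕ) (hN : 0 < N) (y : Fin N → ℤ)
    (U : QWalk.State →L[ℂ] QWalk.State)
    (hU : U = QWalk.walk
      (QWalk.defectCoin (QWalk.defectSet y) (QWalk.coinOne β' γ') C₂)) :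
    -- (1) the essential spectrum
    QWalk.essSpectrum U = QWalk.onCircle (QWalk.arcAngles p γ) ∧
    -- (2) the two eigenvalues, with eigenfunctions supported in the defect set
    (∀ ε : ℂ, ε = 1 ∨ ε = -1 →
      ε * Complex.I * Complex.exp (Complex.I * (γ' / 2)) ∈ QWalk.pointSpectrum U ∧
      (∃ Ψ : QWalk.State, Ψ ≠ 0 ∧
        U Ψ = (ε * Complex.I * Complex.exp (Complex.I * (γ' / 2))) • Ψ ∧
        ∀ x : ℤ, x ∉ QWalk.defectSet y → Ψ x = 0) ∧
      (∀ j : Fin N, ‖QWalk.edgeState β' γ' ε (y j)‖ = 1) ∧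
      (∀ κ : Fin N → ℂ,
        U (∑ j, κ j • QWalk.edgeState β' γ' ε (y j)) =
          (ε * Complex.I * Complex.exp (Complex.I * (γ' / 2))) •
            ∑ j, κ j • QWalk.edgeState β' γ' ε (y j) ∧
        ∀ x : ℤ, x ∉ QWalk.defectSet y →
          (∑ j, κ j • QWalk.edgeState β' γ' ε (y j)) x = 0)) ∧
    -- (3) embedded eigenvalues
    ((γ' + Real.pi) / 2 ∈ QWalk.arcAngles p γ \ QWalk.thresholdAngles p γ →
      ∀ ε : ℂ, ε = 1 ∨ ε = -1 →
        ε * Complex.I * Complex.exp (Complex.I * (γ' / 2)) ∈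
          QWalk.pointSpectrum U ∩ (QWalk.essSpectrum U \ QWalk.thresholds U p γ) ∧
        ∀ Ψ : QWalk.State,
          U Ψ = (ε * Complex.I * Complex.exp (Complex.I * (γ' / 2))) • Ψ →
          ∀ x : ℤ, (QWalk.defectSet y).max' (QWalk.defectSet_nonempty hN y) < x ∨
              x < (QWalk.defectSet y).min' (QWalk.defectSet_nonempty hN y) →
            Ψ x = 0) := by
  subst hU
  obtain ⟨ρ, hρ, M, hM, hC₂⟩ := hexp
  obtain ⟨δ, hδ, hCδ⟩ := hnondeg
  have hp0 : 0 < p := hp.1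
  set A : Matrix.unitaryGroup (Fin 2) ℂ :=
    ⟨QWalk.coinZero p q α β γ, QWalk.coinZero_mem hpq α β γ⟩ with hA
  set C := QWalk.defectCoin (QWalk.defectSet y) (QWalk.coinOne β' γ') C₂ with hC
  have hCout : ∀ x, x ∉ QWalk.defectSet y → C x = C₂ x := fun x hx => if_neg hx
  have hdecay : Summable fun x : ℤ => M * Real.exp (-ρ * Real.sqrt (1 + (x : ℝ) ^ 2)) :=
    (QWalk.summable_exp_neg_sqrt hρ).mul_left M
  have hdist : Summable (QWalk.coinDist C fun _ => A) := by
    refine Summable.of_norm_bounded_eventually (hdecay.mul_left 4) ?_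
    refine (QWalk.defectSet y).finite_toSet.subset fun x hx => ?_
    by_contra hxe
    refine hx ?_
    have hxC := hCout x hxe
    change ‖QWalk.coinDist C (fun _ => A) x‖ ≤ _
    rw [QWalk.coinDist, norm_norm, hxC]
    exact (QWalk.norm_toEuclideanCLM_le _).trans (mul_le_mul_of_nonneg_left (hC₂ x) (by norm_num))
  have hess : QWalk.essSpectrum (QWalk.walk C) = QWalk.onCircle (QWalk.arcAngles p γ) :=
    QWalk.essSpectrum_walk (A := A) hp0 hp.2 hpq rfl hdist
  have hedge : ∀ ε : ℂ, ε = 1 ∨ ε = -1 → ∀ j, QWalk.walk C (QWalk.edgeState β' γ' ε (y j)) =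
      (ε * Complex.I * Complex.exp (Complex.I * (γ' / 2))) • QWalk.edgeState β' γ' ε (y j) :=
    fun ε hε j => QWalk.walk_defectCoin_edgeState y β' γ' C₂ hε j
  have hne : ∀ ε : ℂ, ε = 1 ∨ ε = -1 → ∀ j, QWalk.edgeState β' γ' ε (y j) ≠ 0 := fun ε hε j h => by
    have := QWalk.norm_edgeState β' γ' hε (y j)
    rw [h, norm_zero] at this
    exact zero_ne_one this
  have hpoint : ∀ ε : ℂ, ε = 1 ∨ ε = -1 →
      ε * Complex.I * Complex.exp (Complex.I * (γ' / 2)) ∈ QWalk.pointSpectrum (QWalk.walk C) :=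
    fun ε hε => Module.End.hasEigenvalue_of_hasEigenvector
      ⟨Module.End.mem_eigenspace_iff.2 (hedge ε hε ⟨0, hN⟩), hne ε hε ⟨0, hN⟩⟩
  refine ⟨hess, fun ε hε => ⟨hpoint ε hε, ?_, fun j => QWalk.norm_edgeState β' γ' hε (y j),
    fun κ => ⟨?_, fun x hx => ?_⟩⟩, fun hθ ε hε => ⟨⟨hpoint ε hε, ?_, ?_⟩, ?_⟩⟩
  · exact ⟨_, hne ε hε ⟨0, hN⟩, hedge ε hε ⟨0, hN⟩, fun x hx =>
      QWalk.edgeState_apply_of_notMem_defectSet hx β' γ' ε _⟩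
  · rw [map_sum, Finset.smul_sum]
    refine Finset.sum_congr rfl fun j _ => ?_
    rw [map_smul, hedge ε hε j, smul_comm]
  · rw [lp.coeFn_sum, Finset.sum_apply]
    refine Finset.sum_eq_zero fun j _ => ?_
    rw [lp.coeFn_smul, Pi.smul_apply, QWalk.edgeState_apply_of_notMem_defectSet hx, smul_zero]
  · rw [hess, QWalk.mem_onCircle_arcAngles_iff hp0 hp.2, QWalk.abs_tiltedRe_edge_eigenvalue γ γ' hε]
    exact ⟨QWalk.norm_edge_eigenvalue γ' hε, QWalk.abs_cos_le_of_mem_arcAngles hp0 hp.2 hθ.1⟩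
  · rintro ⟨-, ht⟩
    have h1 := QWalk.abs_tiltedRe_of_mem_thresholdAngles hp0 hp.2 ht
    rw [QWalk.abs_tiltedRe_edge_eigenvalue γ γ' hε] at h1
    exact (QWalk.abs_cos_lt_of_mem_arcAngles_diff hp0 hp.2 hθ).ne h1
  · intro Ψ hΨ x hx
    have hr : |QWalk.tiltedRe γ (ε * Complex.I * Complex.exp (Complex.I * (γ' / 2)))| < p := by
      rw [QWalk.abs_tiltedRe_edge_eigenvalue γ γ' hε]
      exact QWalk.abs_cos_lt_of_mem_arcAngles_diff hp0 hp.2 hθ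
    have hz := QWalk.norm_edge_eigenvalue γ' hε
    have hentry : ∀ x, x ∉ QWalk.defectSet y → ∀ i j, ‖(C x).1 i j - A.1 i j‖ ≤
        M * Real.exp (-ρ * Real.sqrt (1 + (x : ℝ) ^ 2)) := fun x hx i j => by
      rw [hCout x hx]
      exact (QWalk.norm_entry_le_entryMax ((C₂ x).1 - A.1) i j).trans (hC₂ x)
    have hdiag : ∀ x, x ∉ QWalk.defectSet y → δ ≤ ‖(C x).1 0 0‖ := fun x hx => by
      rw [hCout x hx]
      exact hCδ x
    rcases hx with hx | hx
    · have hout : ∀ x, (QWalk.defectSet y).max' (QWalk.defectSet_nonempty hN y) < x →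
          x ∉ QWalk.defectSet y := fun x hx hxe => absurd (Finset.le_max' _ x hxe) (not_le.2 hx)
      exact QWalk.eigenfunction_eq_zero_right (A := A) hp0 hpq rfl hdecay hδ
        (fun x hx => hentry x (hout x hx)) (fun x hx => hdiag x (hout x hx)) hz hr hΨ hx
    · have hout : ∀ x, x < (QWalk.defectSet y).min' (QWalk.defectSet_nonempty hN y) →
          x ∉ QWalk.defectSet y := fun x hx hxe => absurd (Finset.min'_le _ x hxe) (not_le.2 hx)
      exact QWalk.eigenfunction_eq_zero_left (A := A) hp0 hpq rfl hdecay hδ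
        (fun x hx => hentry x (hout x hx)) (fun x hx => hdiag x (hout x hx)) hz hr hΨ hx
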